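/- Let $r\in\{2,3,\dots,\infty,\omega\}$, let $n\ge 2$, let $k\in\mathbb{R}$, and let $M$ be a nonempty $(n-1)$-dimensional manifold of class $C^{r+1}$ with a pseudo-Riemannian metric $g_k$ of class $C^r$ (of any signature) that is Einstein with $\mathrm{Ric}=k(n-2)\,g_k$. Let $I\subseteq\mathbb{R}$ be a nonempty open interval, let $u:I\to\mathbb{R}$ be a positive function of class $C^{r+1}$, and put $g_*=dx^2+u(x)^2g_k$ on the $n$-dimensional manifold $M_*=I\times M$. The Ricci tensor is $\mathrm{Ric}(X,Y)=\mathrm{trace}(V\mapsto R(V,X)Y)$ with $R(X,Y)Z=\nabla_X\nabla_YZ-\nabla_Y\nabla_XZ-\nabla_{[X,Y]}Z$, $\nabla^2f$ is the Hessian, and $\Delta f$ is its trace; the subscript $*$ refers to $g_*$. (1) Suppose that $u$ is not constant, and let $f=f(x)$ be a $C^2$ function on $I$ that is not identically zero, regarded as a function on $M_*$. Then $$f\,\mathrm{Ric}_*-\nabla^2_*f+\Delta_*f\; g_*=0\quad\text{on } M_*$$ holds if and only if $f=a\,u'$ on $I$ for some constant $a\neq 0$ and $$u^2u'''+(n-3)\,u\,u'u''-(n-2)\,u'^3+k(n-2)\,u'=0\quad\text{on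 } I.\qquad(\ast)$$ (2) If $u$ satisfies $(\ast)$ and $u'$ has no zero in $I$, then for each choice of sign $$\overline g=\pm u'(x)^2dt^2+dx^2+u(x)^2g_k$$ is an Einstein metric of class $C^r$ on $\mathbb{R}\times I\times M$ (hence on $I\times I\times M$), that is, a pseudo-Riemannian metric with $\overline{\mathrm{Ric}}=\lambda\,\overline g$ for a constant $\lambda$. (3) The form $\overline g$ is the warped product $g_*+u'(x)^2(\pm dt^2)$ with $n$-dimensional base and $1$-dimensional fibre, and also the warped product $(\pm u'(x)^2dt^2+dx^2)+u(x)^2g_k$ with base in the $(t,x)$-plane. -/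

import Mathlib

set_option maxSynthPendingDepth 3

open scoped Manifold ContDiff

noncomputable section

namespace PseudoRiem

/-! ### Metrics on open subsets of a finite-dimensional vector space

A metric on (an open subset of) a vector space `E` is a field `G : E → E →L[ℝ] E →L[ℝ] ℝ` of
bilinear forms. All formulas are the classical ones for constant coordinate vector fields. -/

section Coordinates

variable {E : Type*} [NormedAddCommGroup E] [NormedSpace ℝ E]

/-- Christoffel symbols of the first kind: `[v, w; z] = ½ (∂_v G(w,z) + ∂_w G(v,z) - ∂_z G(v,w))`,
as a bilinear map in `v, w` with values in the dual space (the variable `z`). -/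
def christoffelLow (G : E → E →L[ℝ] E →L[ℝ] ℝ) (y : E) : E →L[ℝ] E →L[ℝ] E →L[ℝ] ℝ :=
  let D : E →L[ℝ] E →L[ℝ] E →L[ℝ] ℝ := fderiv ℝ G y
  let T : (E →L[ℝ] E →L[ℝ] ℝ) →L[ℝ] (E →L[ℝ] E →L[ℝ] ℝ) :=
    (ContinuousLinearMap.flipₗᵢ ℝ E E ℝ).toContinuousLinearEquiv.toContinuousLinearMap
  (1 / 2 : ℝ) • (D + D.flip - T.comp D.flip)

theorem christoffelLow_apply (G : E → E →L[ℝ] E →L[ℝ] ℝ) (y v w z : E) :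
    christoffelLow G y v w z =
      (1 / 2) * (fderiv ℝ G y v w z + fderiv ℝ G y w v z - fderiv ℝ G y z v w) := by
  simp [christoffelLow]

/-- Christoffel symbols `Γ(v, w) = ∇_v w` of the Levi-Civita connection. The index is raised with
the inverse of `G y : E → E*`. -/
def christoffel (G : E → E →L[ℝ] E →L[ℝ] ℝ) (y : E) : E →L[ℝ] E →L[ℝ] E :=
  (ContinuousLinearMap.compL ℝ E (E →L[ℝ] ℝ) E (G y).inverse) ∘L christoffelLow G y

theorem christoffel_apply (G : E → E →L[ℝ] E →L[ℝ] ℝ) (y v w : E) :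
    christoffel G y v w = (G y).inverse (christoffelLow G y v w) := by
  simp [christoffel]

/-- The endomorphism `V ↦ R(V, X) Y`, where
`R(X, Y) Z = ∇_X ∇_Y Z - ∇_Y ∇_X Z - ∇_[X, Y] Z`. -/
def curvatureEnd (G : E → E →L[ℝ] E →L[ℝ] ℝ) (y X Y : E) : E →L[ℝ] E :=
  ((fderiv ℝ (christoffel G) y).flip X).flip Y
    - (fderiv ℝ (christoffel G) y X).flip Y
    + (christoffel G y).flip (christoffel G y X Y)
    - (christoffel G y X) ∘L ((christoffel G y).flip Y)

theorem curvatureEnd_apply (G : E → E →L[ℝ] E →L[ℝ] ℝ) (y X Y V : E) :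
    curvatureEnd G y X Y V =
      fderiv ℝ (christoffel G) y V X Y - fderiv ℝ (christoffel G) y X V Y
        + christoffel G y V (christoffel G y X Y) - christoffel G y X (christoffel G y V Y) := by
  simp [curvatureEnd]

/-- `Ric(X, Y) = trace (V ↦ R(V, X) Y)`. -/
def ricciCoord (G : E → E →L[ℝ] E →L[ℝ] ℝ) (y X Y : E) : ℝ :=
  LinearMap.trace ℝ E (curvatureEnd G y X Y : E →ₗ[ℝ] E)

/-- The Hessian `∇²h(X, Y) = ∂_X ∂_Y h - dh(Γ(X, Y))`. -/
def hessianCoord (G : E → E →L[ℝ] E →L[ℝ] ℝ) (h : E → ℝ) (y : E) : E →L[ℝ] E →L[ℝ] ℝ :=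
  fderiv ℝ (fderiv ℝ h) y
    - (ContinuousLinearMap.compL ℝ E E ℝ (fderiv ℝ h y)) ∘L christoffel G y

theorem hessianCoord_apply (G : E → E →L[ℝ] E →L[ℝ] ℝ) (h : E → ℝ) (y X Y : E) :
    hessianCoord G h y X Y =
      fderiv ℝ (fderiv ℝ h) y X Y - fderiv ℝ h y (christoffel G y X Y) := by
  simp [hessianCoord]

/-- The Laplacian `Δh`, i.e. the trace with respect to `G` of the Hessian. -/
def laplacianCoord (G : E → E →L[ℝ] E →L[ℝ] ℝ) (h : E → ℝ) (y : E) : ℝ :=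
  LinearMap.trace ℝ E ((G y).inverse ∘L hessianCoord G h y : E →L[ℝ] E)

end Coordinates

/-! ### Manifolds (without boundary) -/

section Manifold

variable {E : Type*} [NormedAddCommGroup E] [NormedSpace ℝ E]
  {H : Type*} [TopologicalSpace H] (I : ModelWithCorners ℝ E H)
  (M : Type*) [TopologicalSpace M] [ChartedSpace H M]

/-- Fields of bilinear forms on the tangent spaces, i.e. `(0, 2)`-tensor fields. -/
abbrev BilinField : Type _ :=
  (p : M) → TangentSpace I p →L[ℝ] TangentSpace I p →L[ℝ] ℝ

variable {I M}

/-- The coordinate expression of `g` in the preferred chart `φ` at `p`, that is, the pullback of `g`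
under `φ⁻¹`. -/
def BilinField.inChart (g : BilinField I M) (p : M) (y : E) : E →L[ℝ] E →L[ℝ] ℝ :=
  let A : E →L[ℝ] E := mfderiv 𝓘(ℝ, E) I (extChartAt I p).symm y
  let B : E →L[ℝ] E →L[ℝ] ℝ := g ((extChartAt I p).symm y)
  B.bilinearComp A A

/-- `g` is a pseudo-Riemannian metric (of any signature) of class `C^r` on the open set `U`. -/
structure IsMetricOn (r : WithTop ℕ∞) (g : BilinField I M) (U : Set M) : Prop where
  symmetric : ∀ p ∈ U, ∀ v w : TangentSpace I p, g p v w = g p w v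
  nondegenerate : ∀ p ∈ U, ∀ v : TangentSpace I p, (∀ w, g p v w = 0) → v = 0
  contDiff : ∀ p ∈ U, ContDiffAt ℝ r (g.inChart p) (extChartAt I p p)

/-- The Ricci tensor of `g` at `p`, computed in the preferred chart at `p`, whose derivative at `p`
is the identification of `TangentSpace I p` with `E`. -/
def ricci (g : BilinField I M) (p : M) (X Y : TangentSpace I p) : ℝ :=
  ricciCoord (g.inChart p) (extChartAt I p p) X Y

/-- The Hessian `∇²f` with respect to `g`. -/
def hessian (g : BilinField I M) (f : M → ℝ) (p : M) (X Y : TangentSpace I p) : ℝ :=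
  hessianCoord (g.inChart p) (f ∘ (extChartAt I p).symm) (extChartAt I p p) X Y

/-- The Laplacian `Δf` with respect to `g`. -/
def laplacian (g : BilinField I M) (f : M → ℝ) (p : M) : ℝ :=
  laplacianCoord (g.inChart p) (f ∘ (extChartAt I p).symm) (extChartAt I p p)

/-- `g` is an Einstein metric of class `C^r` on the open set `U`, with Einstein constant `c`. -/
def IsEinsteinOn (r : WithTop ℕ∞) (g : BilinField I M) (U : Set M) (c : ℝ) : Prop :=
  IsMetricOn r g U ∧ ∀ p ∈ U, ∀ X Y : TangentSpace I p, ricci g p X Y = c * g p X Y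

/-- The equation `f Ric - ∇²f + Δf g = 0` on `U`. -/
def StaticEquationOn (g : BilinField I M) (f : M → ℝ) (U : Set M) : Prop :=
  ∀ p ∈ U, ∀ X Y : TangentSpace I p,
    f p * ricci g p X Y - hessian g f p X Y + laplacian g f p * g p X Y = 0

end Manifold

/-! ### Warped products -/

section Warped

variable {E : Type*} [NormedAddCommGroup E] [NormedSpace ℝ E]
  {H : Type*} [TopologicalSpace H] {I : ModelWithCorners ℝ E H}
  {M : Type*} [TopologicalSpace M] [ChartedSpace H M]
  {E' : Type*} [NormedAddCommGroup E'] [NormedSpace ℝ E']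
  {H' : Type*} [TopologicalSpace H'] {I' : ModelWithCorners ℝ E' H'}
  {N : Type*} [TopologicalSpace N] [ChartedSpace H' N]

/-- The form `((v₁, v₂), (w₁, w₂)) ↦ B₁(v₁, w₁) + B₂(v₂, w₂)` on a product. -/
def orthSum (B₁ : E →L[ℝ] E →L[ℝ] ℝ) (B₂ : E' →L[ℝ] E' →L[ℝ] ℝ) :
    (E × E') →L[ℝ] (E × E') →L[ℝ] ℝ :=
  B₁.bilinearComp (ContinuousLinearMap.fst ℝ E E') (ContinuousLinearMap.fst ℝ E E')
    + B₂.bilinearComp (ContinuousLinearMap.snd ℝ E E') (ContinuousLinearMap.snd ℝ E E')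

theorem orthSum_apply (B₁ : E →L[ℝ] E →L[ℝ] ℝ) (B₂ : E' →L[ℝ] E' →L[ℝ] ℝ) (v w : E × E') :
    orthSum B₁ B₂ v w = B₁ v.1 w.1 + B₂ v.2 w.2 := by
  simp [orthSum]

/-- The warped product `g_B + w² g_F` on `B × F` with warping function `w : B → ℝ`. -/
def warpedProduct (gB : BilinField I M) (w : M → ℝ) (gF : BilinField I' N) :
    BilinField (I.prod I') (M × N) :=
  fun z => orthSum (gB z.1 : E →L[ℝ] E →L[ℝ] ℝ) (w z.1 ^ 2 • (gF z.2 : E' →L[ℝ] E' →L[ℝ] ℝ))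

/-- The form `ε ds²` on the real line. -/
def lineMetric (ε : ℝ) : BilinField 𝓘(ℝ, ℝ) ℝ :=
  fun _ => ε • (ContinuousLinearMap.mul ℝ ℝ : ℝ →L[ℝ] ℝ →L[ℝ] ℝ)

/-- The metric `dx² + u(x)² g` on `ℝ × M` (to be restricted to an open set `I × M`). -/
def warpedOverLine (u : ℝ → ℝ) (g : BilinField I M) :
    BilinField (𝓘(ℝ, ℝ).prod I) (ℝ × M) :=
  warpedProduct (lineMetric 1) u g

/-- The metric `ε q(x)² dt² + dx²` in the `(t, x)`-plane. -/
def planeMetric (ε : ℝ) (q : ℝ → ℝ) : BilinField (𝓘(ℝ, ℝ).prod 𝓘(ℝ, ℝ)) (ℝ × ℝ) :=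
  fun z => orthSum ((ε * q z.2 ^ 2) • (ContinuousLinearMap.mul ℝ ℝ : ℝ →L[ℝ] ℝ →L[ℝ] ℝ))
    (ContinuousLinearMap.mul ℝ ℝ : ℝ →L[ℝ] ℝ →L[ℝ] ℝ)

/-- The metric `ε u'(x)² dt² + dx² + u(x)² g` in the variables `(t, x, p)`. -/
def iteratedWarped (ε : ℝ) (u : ℝ → ℝ) (g : BilinField I M) :
    BilinField (𝓘(ℝ, ℝ).prod (𝓘(ℝ, ℝ).prod I)) (ℝ × (ℝ × M)) :=
  fun z => orthSum
    ((ε * deriv u z.2.1 ^ 2) • (ContinuousLinearMap.mul ℝ ℝ : ℝ →L[ℝ] ℝ →L[ℝ] ℝ))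
    (warpedOverLine u g z.2 : (ℝ × E) →L[ℝ] (ℝ × E) →L[ℝ] ℝ)

end Warped

end PseudoRiem

end

section CoordinateMetrics

open PseudoRiem Topology

variable {E : Type*} [NormedAddCommGroup E] [NormedSpace ℝ E]

/-- `G` is near `y` a symmetric nondegenerate field of bilinear forms of class `C²`. -/
structure IsCoordMetricAt (G : E → E →L[ℝ] E →L[ℝ] ℝ) (y : E) : Prop where
  contDiffAt : ContDiffAt ℝ 2 G y
  eventually_symm : ∀ᶠ z in 𝓝 y, ∀ v w, G z v w = G z w v
  isInvertible : (G y).IsInvertible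

theorem ContinuousLinearMap.isInvertible_of_nondegenerate [FiniteDimensional ℝ E]
    (B : E →L[ℝ] E →L[ℝ] ℝ) (h : ∀ v, (∀ w, B v w = 0) → v = 0) : B.IsInvertible := by
  have hinj : Function.Injective (B : E →ₗ[ℝ] E →L[ℝ] ℝ) := by
    rw [injective_iff_map_eq_zero]
    intro v hv
    exact h v fun w => by simpa using congrArg (fun L : E →L[ℝ] ℝ => L w) hv
  have hdim : Module.finrank ℝ E = Module.finrank ℝ (E →L[ℝ] ℝ) := by
    rw [← (LinearMap.toContinuousLinearMap : (E →ₗ[ℝ] ℝ) ≃ₗ[ℝ] (E →L[ℝ] ℝ)).finrank_eq]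
    exact (Subspace.dual_finrank_eq (K := ℝ) (V := E)).symm
  exact ⟨(LinearEquiv.ofInjectiveOfFinrankEq _ hinj hdim).toContinuousLinearEquiv, by ext; rfl⟩

namespace IsCoordMetricAt

variable {G : E → E →L[ℝ] E →L[ℝ] ℝ} {y : E}

theorem symm (h : IsCoordMetricAt G y) (v w : E) : G y v w = G y w v :=
  h.eventually_symm.self_of_nhds v w

theorem ext_left (h : IsCoordMetricAt G y) {a b : E} (hab : ∀ z, G y a z = G y b z) : a = b :=
  h.isInvertible.injective (ContinuousLinearMap.ext hab)

theorem differentiableAt (h : IsCoordMetricAt G y) : DifferentiableAt ℝ G y :=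
  h.contDiffAt.differentiableAt (by norm_num)

theorem eventually [CompleteSpace E] (h : IsCoordMetricAt G y) :
    ∀ᶠ z in 𝓝 y, IsCoordMetricAt G z := by
  obtain ⟨e, he⟩ := h.isInvertible
  have hinv : ∀ᶠ z in 𝓝 y, G z ∈ Set.range ((↑) : (E ≃L[ℝ] (E →L[ℝ] ℝ)) → _) :=
    h.contDiffAt.continuousAt.eventually (by rw [← he]; exact ContinuousLinearEquiv.nhds e)
  filter_upwards [h.contDiffAt.eventually (by decide), h.eventually_symm.eventually_nhds, hinv]
    with z h1 h2 h3
  exact ⟨h1, h2, h3⟩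

theorem fderiv_apply_apply (h : IsCoordMetricAt G y) (x v w : E) :
    fderiv ℝ (fun z => G z v w) y x = fderiv ℝ G y x v w := by
  have := ((h.differentiableAt.hasFDerivAt.clm_apply (hasFDerivAt_const v y)).clm_apply
    (hasFDerivAt_const w y)).fderiv
  simp [this]

theorem fderiv_symm (h : IsCoordMetricAt G y) (x v w : E) :
    fderiv ℝ G y x v w = fderiv ℝ G y x w v := by
  rw [← h.fderiv_apply_apply, ← h.fderiv_apply_apply]
  congr 1
  apply Filter.EventuallyEq.fderiv_eq
  filter_upwards [h.eventually_symm] with z hz using hz v w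

theorem apply_christoffel (h : IsCoordMetricAt G y) (v w z : E) :
    G y (christoffel G y v w) z = christoffelLow G y v w z := by
  rw [christoffel_apply, h.isInvertible.self_apply_inverse]

theorem christoffel_eq (h : IsCoordMetricAt G y) {v w a : E}
    (ha : ∀ z, G y a z = christoffelLow G y v w z) : christoffel G y v w = a :=
  h.ext_left fun z => by rw [h.apply_christoffel, ha]

theorem christoffel_symm (h : IsCoordMetricAt G y) (v w : E) :
    christoffel G y v w = christoffel G y w v :=
  h.christoffel_eq fun z => by
    rw [h.apply_christoffel, christoffelLow_apply, christoffelLow_apply, h.fderiv_symm z]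
    ring

theorem fderiv_eq_christoffel (h : IsCoordMetricAt G y) (x v w : E) :
    fderiv ℝ G y x v w = G y (christoffel G y x v) w + G y v (christoffel G y x w) := by
  rw [h.symm v, h.apply_christoffel, h.apply_christoffel, christoffelLow_apply,
    christoffelLow_apply, h.fderiv_symm v, h.fderiv_symm x w v, h.fderiv_symm w]
  ring

theorem differentiableAt_christoffelLow (h : IsCoordMetricAt G y) :
    DifferentiableAt ℝ (christoffelLow G) y := by
  have hD : DifferentiableAt ℝ (fderiv ℝ G) y :=
    (h.contDiffAt.fderiv_right (m := 1) (by norm_num)).differentiableAt (by norm_num)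
  have hF : DifferentiableAt ℝ (fun z => (fderiv ℝ G z).flip) y :=
    (ContinuousLinearMap.flipₗᵢ ℝ E E (E →L[ℝ] ℝ)).toContinuousLinearEquiv.differentiableAt.comp
      y hD
  exact ((hD.add hF).sub ((differentiableAt_const _).clm_comp hF)).const_smul (1 / 2 : ℝ)

theorem differentiableAt_inverse [CompleteSpace E] (h : IsCoordMetricAt G y) :
    DifferentiableAt ℝ (fun z => (G z).inverse) y :=
  ((h.isInvertible.contDiffAt_map_inverse (n := 1)).differentiableAt (by norm_num)).comp y
    h.differentiableAt

theorem differentiableAt_christoffel [CompleteSpace E] (h : IsCoordMetricAt G y) :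
    DifferentiableAt ℝ (christoffel G) y :=
  (((ContinuousLinearMap.compL ℝ E (E →L[ℝ] ℝ) E).differentiableAt).comp y
    h.differentiableAt_inverse).clm_comp h.differentiableAt_christoffelLow

theorem hasFDerivAt_christoffel_apply [CompleteSpace E] (h : IsCoordMetricAt G y) (v w : E) :
    HasFDerivAt (fun z => christoffel G z v w)
      (((fderiv ℝ (christoffel G) y).flip v).flip w) y := by
  have := (h.differentiableAt_christoffel.hasFDerivAt.clm_apply (hasFDerivAt_const v y)).clm_apply
    (hasFDerivAt_const w y)
  refine this.congr_fderiv ?_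
  ext x
  simp

theorem fderiv_christoffel_apply [CompleteSpace E] (h : IsCoordMetricAt G y) {v w x a : E}
    {Γ : E → E} {Γ' : E →L[ℝ] E} (hΓ : ∀ᶠ z in 𝓝 y, christoffel G z v w = Γ z)
    (hΓ' : HasFDerivAt Γ Γ' y) (ha : Γ' x = a) :
    fderiv ℝ (christoffel G) y x v w = a := by
  rw [← ha, ((h.hasFDerivAt_christoffel_apply v w).congr_of_eventuallyEq
    (Filter.EventuallyEq.symm hΓ)).unique hΓ' |>.symm]
  simp

end IsCoordMetricAt

/-- The trace of an endomorphism of a product is the sum of the traces of the diagonal blocks. -/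
theorem LinearMap.trace_prod_eq {V W : Type*} [AddCommGroup V] [Module ℝ V]
    [AddCommGroup W] [Module ℝ W] [FiniteDimensional ℝ V] [FiniteDimensional ℝ W]
    (L : V × W →ₗ[ℝ] V × W) :
    LinearMap.trace ℝ (V × W) L =
      LinearMap.trace ℝ V (LinearMap.fst ℝ V W ∘ₗ L ∘ₗ LinearMap.inl ℝ V W)
        + LinearMap.trace ℝ W (LinearMap.snd ℝ V W ∘ₗ L ∘ₗ LinearMap.inr ℝ V W) := by
  rw [LinearMap.trace_comp_comm' _ (LinearMap.fst ℝ V W),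
    LinearMap.trace_comp_comm' _ (LinearMap.snd ℝ V W), ← map_add, LinearMap.comp_assoc, LinearMap.comp_assoc,
    ← LinearMap.comp_add]
  congr 1
  ext x <;> simp

theorem LinearMap.trace_real (L : ℝ →ₗ[ℝ] ℝ) : LinearMap.trace ℝ ℝ L = L 1 := by
  rw [LinearMap.trace_eq_matrix_trace ℝ (Module.Basis.singleton Unit ℝ)]
  simp [Matrix.trace, LinearMap.toMatrix_apply]

theorem LinearMap.trace_real_prod_eq {W : Type*} [AddCommGroup W] [Module ℝ W]
    [FiniteDimensional ℝ W] (L : ℝ × W →ₗ[ℝ] ℝ × W) (A : W →ₗ[ℝ] W)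
    (hA : ∀ w, (L (0, w)).2 = A w) :
    LinearMap.trace ℝ (ℝ × W) L = (L (1, 0)).1 + LinearMap.trace ℝ W A := by
  rw [LinearMap.trace_prod_eq, LinearMap.trace_real]
  congr 2
  ext w
  simp [hA]

end CoordinateMetrics

section WarpedCoordinates

open PseudoRiem Topology

variable {E : Type*} [NormedAddCommGroup E] [NormedSpace ℝ E]
  {E' : Type*} [NormedAddCommGroup E'] [NormedSpace ℝ E']
  {F : Type*} [NormedAddCommGroup F] [NormedSpace ℝ F]

theorem ContDiffAt.bilinearComp {r : WithTop ℕ∞} {B : F → E →L[ℝ] E →L[ℝ] ℝ} {y : F}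
    (hB : ContDiffAt ℝ r B y) (L L' : E' →L[ℝ] E) :
    ContDiffAt ℝ r (fun z => (B z).bilinearComp L L') y := by
  have h1 : ContDiffAt ℝ r (fun z => ((B z).comp L).flip) y :=
    (ContinuousLinearMap.flipₗᵢ ℝ E' E ℝ).toContinuousLinearEquiv.contDiff.contDiffAt.comp y
      (hB.clm_comp contDiffAt_const)
  exact (ContinuousLinearMap.flipₗᵢ ℝ E' E' ℝ).toContinuousLinearEquiv.contDiff.contDiffAt.comp y
    (h1.clm_comp contDiffAt_const)

theorem ContDiffAt.orthSum {r : WithTop ℕ∞} {B : F → E →L[ℝ] E →L[ℝ] ℝ}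
    {B' : F → E' →L[ℝ] E' →L[ℝ] ℝ} {y : F}
    (hB : ContDiffAt ℝ r B y) (hB' : ContDiffAt ℝ r B' y) :
    ContDiffAt ℝ r (fun z => PseudoRiem.orthSum (B z) (B' z)) y :=
  (hB.bilinearComp _ _).add (hB'.bilinearComp _ _)

/-- The warped product `dx² + u(x)² G` on `ℝ × E`. -/
noncomputable def warpedCoord (u : ℝ → ℝ) (G : E → E →L[ℝ] E →L[ℝ] ℝ) :
    ℝ × E → (ℝ × E) →L[ℝ] (ℝ × E) →L[ℝ] ℝ :=
  fun z => orthSum (ContinuousLinearMap.mul ℝ ℝ) (u z.1 ^ 2 • G z.2)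

theorem warpedCoord_apply (u : ℝ → ℝ) (G : E → E →L[ℝ] E →L[ℝ] ℝ) (z v w : ℝ × E) :
    warpedCoord u G z v w = v.1 * w.1 + u z.1 ^ 2 * G z.2 v.2 w.2 := by
  simp [warpedCoord, orthSum_apply]

theorem ContDiffAt.warpedCoord {r : WithTop ℕ∞} {u : ℝ → ℝ} {G : E → E →L[ℝ] E →L[ℝ] ℝ}
    {z : ℝ × E} (hu : ContDiffAt ℝ r u z.1) (hG : ContDiffAt ℝ r G z.2) :
    ContDiffAt ℝ r (warpedCoord u G) z :=
  contDiffAt_const.orthSum (((hu.comp z contDiffAt_fst).pow 2).smul (hG.comp z contDiffAt_snd))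

section

variable [FiniteDimensional ℝ E] {u : ℝ → ℝ} {G : E → E →L[ℝ] E →L[ℝ] ℝ} {z : ℝ × E}

theorem IsCoordMetricAt.warpedCoord (hG : IsCoordMetricAt G z.2) (hu : ContDiffAt ℝ 2 u z.1)
    (h0 : u z.1 ≠ 0) : IsCoordMetricAt (warpedCoord u G) z where
  contDiffAt := hu.warpedCoord hG.contDiffAt
  eventually_symm := by
    filter_upwards [continuousAt_snd.eventually hG.eventually_symm] with p hp v w
    rw [warpedCoord_apply, warpedCoord_apply, hp v.2 w.2, mul_comm v.1]
  isInvertible := by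
    refine ContinuousLinearMap.isInvertible_of_nondegenerate _ fun v hv => ?_
    have h1 : v.1 = 0 := by simpa [warpedCoord_apply] using hv (1, 0)
    have h2 : v.2 = 0 := hG.ext_left fun w => by
      simpa [warpedCoord_apply, h0] using hv (0, w)
    exact Prod.ext h1 h2

theorem fderiv_warpedCoord (hG : IsCoordMetricAt G z.2) (hu : ContDiffAt ℝ 2 u z.1)
    (h0 : u z.1 ≠ 0) (a v w : ℝ × E) :
    fderiv ℝ (warpedCoord u G) z a v w =
      2 * u z.1 * deriv u z.1 * a.1 * G z.2 v.2 w.2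
        + u z.1 ^ 2 * fderiv ℝ G z.2 a.2 v.2 w.2 := by
  rw [← (hG.warpedCoord hu h0).fderiv_apply_apply]
  simp only [warpedCoord_apply]
  have h1 : HasFDerivAt (fun p : ℝ × E => u p.1) _ z :=
    (hu.differentiableAt (by norm_num)).hasDerivAt.hasFDerivAt.comp z hasFDerivAt_fst
  have h2 : HasFDerivAt (fun p : ℝ × E => G p.2 v.2 w.2) _ z :=
    ((hG.differentiableAt.hasFDerivAt.comp z hasFDerivAt_snd).clm_apply
      (hasFDerivAt_const v.2 z)).clm_apply (hasFDerivAt_const w.2 z)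
  have h3 : HasFDerivAt (fun p : ℝ × E => v.1 * w.1 + u p.1 ^ 2 * G p.2 v.2 w.2) _ z :=
    ((h1.pow 2).mul h2).const_add (v.1 * w.1)
  rw [h3.fderiv]
  simp
  ring

theorem christoffel_warpedCoord (hG : IsCoordMetricAt G z.2) (hu : ContDiffAt ℝ 2 u z.1)
    (h0 : u z.1 ≠ 0) (v w : ℝ × E) :
    christoffel (warpedCoord u G) z v w =
      (-(u z.1 * deriv u z.1 * G z.2 v.2 w.2),
        christoffel G z.2 v.2 w.2 + (deriv u z.1 / u z.1) • (v.1 • w.2 + w.1 • v.2)) := by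
  refine (hG.warpedCoord hu h0).christoffel_eq fun a => ?_
  rw [christoffelLow_apply, fderiv_warpedCoord hG hu h0, fderiv_warpedCoord hG hu h0,
    fderiv_warpedCoord hG hu h0, warpedCoord_apply]
  simp only [map_add, map_smul, add_apply, smul_apply,
    smul_eq_mul, hG.apply_christoffel, christoffelLow_apply]
  field_simp
  ring

theorem fderiv_christoffel_warpedCoord (hG : IsCoordMetricAt G z.2) (hu : ContDiffAt ℝ 2 u z.1)
    (h0 : u z.1 ≠ 0) (a v w : ℝ × E) :
    fderiv ℝ (christoffel (warpedCoord u G)) z a v w =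
      (-((deriv u z.1 ^ 2 + u z.1 * deriv (deriv u) z.1) * a.1 * G z.2 v.2 w.2
          + u z.1 * deriv u z.1 * fderiv ℝ G z.2 a.2 v.2 w.2),
        fderiv ℝ (christoffel G) z.2 a.2 v.2 w.2
          + ((deriv (deriv u) z.1 / u z.1 - (deriv u z.1 / u z.1) ^ 2) * a.1)
            • (v.1 • w.2 + w.1 • v.2)) := by
  have hu1 : HasDerivAt u (deriv u z.1) z.1 := (hu.differentiableAt (by norm_num)).hasDerivAt
  have hu2 : HasDerivAt (deriv u) (deriv (deriv u) z.1) z.1 :=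
    ((hu.derivWithin (m := 1) (by norm_num)).differentiableAt (by norm_num)).hasDerivAt
  have hev : ∀ᶠ p in 𝓝 z, christoffel (warpedCoord u G) p v w =
      (-(u p.1 * deriv u p.1 * G p.2 v.2 w.2),
        christoffel G p.2 v.2 w.2 + (deriv u p.1 / u p.1) • (v.1 • w.2 + w.1 • v.2)) := by
    filter_upwards [continuousAt_snd.eventually hG.eventually,
      continuousAt_fst.eventually (hu.eventually (by decide)),
      continuousAt_fst.eventually (hu.continuousAt.eventually_ne h0)] with p h1 h2 h3
    exact christoffel_warpedCoord h1 h2 h3 v w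
  have h1 : HasFDerivAt (fun p : ℝ × E => u p.1 * deriv u p.1) _ z :=
    (hu1.mul hu2).hasFDerivAt.comp z hasFDerivAt_fst
  have hdiv : HasDerivAt (fun t => deriv u t / u t)
      (deriv (deriv u) z.1 / u z.1 - (deriv u z.1 / u z.1) ^ 2) z.1 :=
    (hu2.div hu1 h0).congr_deriv (by field_simp)
  have h2 : HasFDerivAt (fun p : ℝ × E => deriv u p.1 / u p.1) _ z :=
    hdiv.hasFDerivAt.comp z hasFDerivAt_fst
  have h3 : HasFDerivAt (fun p : ℝ × E => G p.2 v.2 w.2) _ z :=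
    ((hG.differentiableAt.hasFDerivAt.comp z hasFDerivAt_snd).clm_apply
      (hasFDerivAt_const v.2 z)).clm_apply (hasFDerivAt_const w.2 z)
  have h4 : HasFDerivAt (fun p : ℝ × E => christoffel G p.2 v.2 w.2) _ z :=
    (hG.hasFDerivAt_christoffel_apply v.2 w.2).comp z hasFDerivAt_snd
  refine (hG.warpedCoord hu h0).fderiv_christoffel_apply hev
    ((h1.mul h3).neg.prodMk (h4.add (h2.smul_const (v.1 • w.2 + w.1 • v.2)))) ?_
  refine Prod.ext ?_ ?_
  · simp
    ring
  · simp [mul_comm a.1]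

theorem LinearMap.trace_smulRight' {V : Type*} [AddCommGroup V] [Module ℝ V]
    [FiniteDimensional ℝ V] (f : V →ₗ[ℝ] ℝ) (v : V) :
    LinearMap.trace ℝ V (f.smulRight v) = f v := by
  have h : f.smulRight v = LinearMap.toSpanSingleton ℝ V v ∘ₗ f := by ext; simp
  rw [h, LinearMap.trace_comp_comm', LinearMap.trace_real]
  simp

theorem ricciCoord_warpedCoord (hG : IsCoordMetricAt G z.2) (hu : ContDiffAt ℝ 2 u z.1)
    (h0 : u z.1 ≠ 0) (v w : ℝ × E) :
    ricciCoord (warpedCoord u G) z v w =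
      ricciCoord G z.2 v.2 w.2
        - Module.finrank ℝ E * (deriv (deriv u) z.1 / u z.1) * (v.1 * w.1)
        - (u z.1 * deriv (deriv u) z.1 + (Module.finrank ℝ E - 1) * deriv u z.1 ^ 2)
          * G z.2 v.2 w.2 := by
  let A : E →ₗ[ℝ] E := (curvatureEnd G z.2 v.2 w.2 : E →ₗ[ℝ] E)
    - (deriv (deriv u) z.1 / u z.1 * (v.1 * w.1) + deriv u z.1 ^ 2 * G z.2 v.2 w.2)
      • LinearMap.id
    + deriv u z.1 ^ 2 • ((G z.2).flip w.2 : E →ₗ[ℝ] ℝ).smulRight v.2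
  have hA : ∀ a, (curvatureEnd (warpedCoord u G) z v w (0, a)).2 = A a := by
    intro a
    simp only [curvatureEnd_apply, fderiv_christoffel_warpedCoord hG hu h0,
      christoffel_warpedCoord hG hu h0, A]
    simp [curvatureEnd_apply, hG.christoffel_symm a v.2]
    match_scalars <;> field_simp <;> ring
  have h1 : (curvatureEnd (warpedCoord u G) z v w (1, 0)).1 =
      -(u z.1 * deriv (deriv u) z.1 * G z.2 v.2 w.2) := by
    simp only [curvatureEnd_apply, fderiv_christoffel_warpedCoord hG hu h0,
      christoffel_warpedCoord hG hu h0]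
    simp
    field_simp
    ring
  rw [ricciCoord, LinearMap.trace_real_prod_eq _ A hA]
  simp only [A, map_add, map_sub, map_smul, LinearMap.trace_smulRight', LinearMap.trace_id]
  rw [ContinuousLinearMap.coe_coe, h1, ricciCoord]
  simp
  ring

variable {f : ℝ → ℝ}

theorem hessianCoord_warpedCoord (hG : IsCoordMetricAt G z.2) (hu : ContDiffAt ℝ 2 u z.1)
    (h0 : u z.1 ≠ 0) (hf : ContDiffAt ℝ 2 f z.1) (v w : ℝ × E) :
    hessianCoord (warpedCoord u G) (fun p => f p.1) z v w =
      deriv (deriv f) z.1 * (v.1 * w.1)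
        + deriv f z.1 * (u z.1 * deriv u z.1) * G z.2 v.2 w.2 := by
  have h1 : ∀ p : ℝ × E, DifferentiableAt ℝ f p.1 →
      fderiv ℝ (fun p : ℝ × E => f p.1) p = deriv f p.1 • ContinuousLinearMap.fst ℝ ℝ E := by
    intro p hp
    have : HasFDerivAt (fun p : ℝ × E => f p.1) _ p :=
      hp.hasDerivAt.hasFDerivAt.comp p hasFDerivAt_fst
    rw [this.fderiv]
    ext <;> simp
  have h2 : fderiv ℝ (fun p : ℝ × E => f p.1) =ᶠ[𝓝 z]
      fun p => deriv f p.1 • ContinuousLinearMap.fst ℝ ℝ E := by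
    filter_upwards [continuousAt_fst.eventually (hf.eventually (by decide))] with p hp
    exact h1 p (hp.differentiableAt (by norm_num))
  have hf2 : HasDerivAt (deriv f) (deriv (deriv f) z.1) z.1 :=
    ((hf.derivWithin (m := 1) (by norm_num)).differentiableAt (by norm_num)).hasDerivAt
  have h3 : HasFDerivAt (fun p : ℝ × E => deriv f p.1) _ z :=
    hf2.hasFDerivAt.comp z hasFDerivAt_fst
  rw [hessianCoord_apply, h2.fderiv_eq, h1 z (hf.differentiableAt (by norm_num)),
    (h3.smul_const (ContinuousLinearMap.fst ℝ ℝ E)).fderiv, christoffel_warpedCoord hG hu h0]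
  simp
  ring

theorem laplacianCoord_warpedCoord (hG : IsCoordMetricAt G z.2) (hu : ContDiffAt ℝ 2 u z.1)
    (h0 : u z.1 ≠ 0) (hf : ContDiffAt ℝ 2 f z.1) :
    laplacianCoord (warpedCoord u G) (fun p => f p.1) z =
      deriv (deriv f) z.1 + Module.finrank ℝ E * (deriv f z.1 * deriv u z.1 / u z.1) := by
  have hW := hG.warpedCoord hu h0
  have key : ∀ v a : ℝ × E,
      (∀ w, hessianCoord (warpedCoord u G) (fun p => f p.1) z v w = warpedCoord u G z a w) →
      ((warpedCoord u G z).inverse ∘L hessianCoord (warpedCoord u G) (fun p => f p.1) z) v = a := by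
    intro v a h
    rw [ContinuousLinearMap.comp_apply, hW.isInvertible.inverse_apply_eq]
    exact ContinuousLinearMap.ext h
  rw [laplacianCoord, LinearMap.trace_real_prod_eq _
    ((deriv f z.1 * deriv u z.1 / u z.1) • (LinearMap.id : E →ₗ[ℝ] E))]
  · rw [ContinuousLinearMap.coe_coe, key (1, 0) (deriv (deriv f) z.1, 0)]
    · simp
      ring
    · intro w
      simp [hessianCoord_warpedCoord hG hu h0 hf, warpedCoord_apply]
  · intro a
    rw [ContinuousLinearMap.coe_coe, key (0, a) (0, (deriv f z.1 * deriv u z.1 / u z.1) • a)]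
    · simp
    · intro w
      simp [hessianCoord_warpedCoord hG hu h0 hf, warpedCoord_apply]
      field_simp

end

end WarpedCoordinates

section StaticCoordinates

open PseudoRiem Topology

variable {F : Type*} [NormedAddCommGroup F] [NormedSpace ℝ F]

/-- The gradient of `q` with respect to `H`. -/
noncomputable def gradCoord (H : F → F →L[ℝ] F →L[ℝ] ℝ) (q : F → ℝ) (y : F) : F :=
  (H y).inverse (fderiv ℝ q y)

namespace IsCoordMetricAt

variable {H : F → F →L[ℝ] F →L[ℝ] ℝ} {q : F → ℝ} {y : F}

theorem apply_gradCoord (hH : IsCoordMetricAt H y) (w : F) :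
    H y (gradCoord H q y) w = fderiv ℝ q y w := by
  rw [gradCoord, hH.isInvertible.self_apply_inverse]

theorem differentiableAt_gradCoord [CompleteSpace F] (hH : IsCoordMetricAt H y)
    (hq : ContDiffAt ℝ 2 q y) : DifferentiableAt ℝ (gradCoord H q) y :=
  hH.differentiableAt_inverse.clm_apply
    ((hq.fderiv_right (m := 1) (by norm_num)).differentiableAt (by norm_num))

theorem apply_fderiv_gradCoord [CompleteSpace F] (hH : IsCoordMetricAt H y)
    (hq : ContDiffAt ℝ 2 q y) (a w : F) :
    H y (fderiv ℝ (gradCoord H q) y a + christoffel H y a (gradCoord H q y)) w =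
      hessianCoord H q y a w := by
  have hq2 : DifferentiableAt ℝ (fderiv ℝ q) y :=
    (hq.fderiv_right (m := 1) (by norm_num)).differentiableAt (by norm_num)
  have h1 : HasFDerivAt (fun p => H p (gradCoord H q p) w) _ y :=
    (hH.differentiableAt.hasFDerivAt.clm_apply
      (hH.differentiableAt_gradCoord hq).hasFDerivAt).clm_apply (hasFDerivAt_const w y)
  have h2 : HasFDerivAt (fun p => fderiv ℝ q p w) _ y :=
    hq2.hasFDerivAt.clm_apply (hasFDerivAt_const w y)
  have h3 : (fun p => H p (gradCoord H q p) w) =ᶠ[𝓝 y] fun p => fderiv ℝ q p w := by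
    filter_upwards [hH.eventually] with p hp using hp.apply_gradCoord w
  have h4 := congrArg (fun L : F →L[ℝ] ℝ => L a) ((h2.congr_of_eventuallyEq h3).unique h1)
  simp at h4
  rw [hH.fderiv_eq_christoffel, hH.apply_gradCoord] at h4
  rw [hessianCoord_apply, h4]
  simp
  ring

theorem fderiv_gradCoord_add [CompleteSpace F] (hH : IsCoordMetricAt H y)
    (hq : ContDiffAt ℝ 2 q y) (a : F) :
    fderiv ℝ (gradCoord H q) y a + christoffel H y a (gradCoord H q y) =
      ((H y).inverse ∘L hessianCoord H q y) a := by
  rw [ContinuousLinearMap.comp_apply, eq_comm, hH.isInvertible.inverse_apply_eq]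
  exact ContinuousLinearMap.ext fun w => (hH.apply_fderiv_gradCoord hq a w).symm

end IsCoordMetricAt

/-- The metric `ε q² dt² + H` on `ℝ × F`, where `q` and `H` do not depend on `t`. -/
noncomputable def staticCoord (ε : ℝ) (q : F → ℝ) (H : F → F →L[ℝ] F →L[ℝ] ℝ) :
    ℝ × F → (ℝ × F) →L[ℝ] (ℝ × F) →L[ℝ] ℝ :=
  fun z => orthSum ((ε * q z.2 ^ 2) • ContinuousLinearMap.mul ℝ ℝ) (H z.2)

theorem staticCoord_apply (ε : ℝ) (q : F → ℝ) (H : F → F →L[ℝ] F →L[ℝ] ℝ) (z v w : ℝ × F) :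
    staticCoord ε q H z v w = ε * q z.2 ^ 2 * (v.1 * w.1) + H z.2 v.2 w.2 := by
  simp [staticCoord, orthSum_apply]

theorem ContDiffAt.staticCoord {r : WithTop ℕ∞} {ε : ℝ} {q : F → ℝ}
    {H : F → F →L[ℝ] F →L[ℝ] ℝ} {z : ℝ × F} (hq : ContDiffAt ℝ r q z.2)
    (hH : ContDiffAt ℝ r H z.2) : ContDiffAt ℝ r (staticCoord ε q H) z :=
  ((contDiffAt_const.mul ((hq.comp z contDiffAt_snd).pow 2)).smul contDiffAt_const).orthSum
    (hH.comp z contDiffAt_snd)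

variable [FiniteDimensional ℝ F] {ε : ℝ} {q : F → ℝ} {H : F → F →L[ℝ] F →L[ℝ] ℝ} {z : ℝ × F}

theorem IsCoordMetricAt.staticCoord (hH : IsCoordMetricAt H z.2) (hq : ContDiffAt ℝ 2 q z.2)
    (h0 : q z.2 ≠ 0) (hε : ε ≠ 0) : IsCoordMetricAt (staticCoord ε q H) z where
  contDiffAt := hq.staticCoord hH.contDiffAt
  eventually_symm := by
    filter_upwards [continuousAt_snd.eventually hH.eventually_symm] with p hp v w
    rw [staticCoord_apply, staticCoord_apply, hp v.2 w.2, mul_comm v.1]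
  isInvertible := by
    refine ContinuousLinearMap.isInvertible_of_nondegenerate _ fun v hv => ?_
    have h1 : v.1 = 0 := by simpa [staticCoord_apply, hε, h0] using hv (1, 0)
    have h2 : v.2 = 0 := hH.ext_left fun w => by
      simpa [staticCoord_apply] using hv (0, w)
    exact Prod.ext h1 h2

theorem fderiv_staticCoord (hH : IsCoordMetricAt H z.2) (hq : ContDiffAt ℝ 2 q z.2)
    (h0 : q z.2 ≠ 0) (hε : ε ≠ 0) (a v w : ℝ × F) :
    fderiv ℝ (staticCoord ε q H) z a v w =
      2 * ε * q z.2 * fderiv ℝ q z.2 a.2 * (v.1 * w.1) + fderiv ℝ H z.2 a.2 v.2 w.2 := by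
  rw [← (hH.staticCoord hq h0 hε).fderiv_apply_apply]
  simp only [staticCoord_apply]
  have h1 : HasFDerivAt (fun p : ℝ × F => q p.2) _ z :=
    (hq.differentiableAt (by norm_num)).hasFDerivAt.comp z hasFDerivAt_snd
  have h2 : HasFDerivAt (fun p : ℝ × F => H p.2 v.2 w.2) _ z :=
    ((hH.differentiableAt.hasFDerivAt.comp z hasFDerivAt_snd).clm_apply
      (hasFDerivAt_const v.2 z)).clm_apply (hasFDerivAt_const w.2 z)
  have h3 : HasFDerivAt (fun p : ℝ × F => ε * q p.2 ^ 2 * (v.1 * w.1) + H p.2 v.2 w.2) _ z :=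
    (((h1.pow 2).const_mul ε).mul_const (v.1 * w.1)).add h2
  rw [h3.fderiv]
  simp
  ring

theorem christoffel_staticCoord (hH : IsCoordMetricAt H z.2) (hq : ContDiffAt ℝ 2 q z.2)
    (h0 : q z.2 ≠ 0) (hε : ε ≠ 0) (v w : ℝ × F) :
    christoffel (staticCoord ε q H) z v w =
      ((fderiv ℝ q z.2 v.2 * w.1 + fderiv ℝ q z.2 w.2 * v.1) / q z.2,
        christoffel H z.2 v.2 w.2 - (q z.2 * (ε * (v.1 * w.1))) • gradCoord H q z.2) := by
  refine (hH.staticCoord hq h0 hε).christoffel_eq fun a => ?_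
  rw [christoffelLow_apply, fderiv_staticCoord hH hq h0 hε, fderiv_staticCoord hH hq h0 hε,
    fderiv_staticCoord hH hq h0 hε, staticCoord_apply]
  simp only [map_sub, map_smul, sub_apply, smul_apply,
    smul_eq_mul, hH.apply_christoffel, christoffelLow_apply, hH.apply_gradCoord]
  field_simp
  ring

theorem fderiv_christoffel_staticCoord (hH : IsCoordMetricAt H z.2) (hq : ContDiffAt ℝ 2 q z.2)
    (h0 : q z.2 ≠ 0) (hε : ε ≠ 0) (a v w : ℝ × F) :
    fderiv ℝ (christoffel (staticCoord ε q H)) z a v w =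
      ((fderiv ℝ (fderiv ℝ q) z.2 a.2 v.2 * w.1 + fderiv ℝ (fderiv ℝ q) z.2 a.2 w.2 * v.1) / q z.2
          - fderiv ℝ q z.2 a.2 * (fderiv ℝ q z.2 v.2 * w.1 + fderiv ℝ q z.2 w.2 * v.1)
            / q z.2 ^ 2,
        fderiv ℝ (christoffel H) z.2 a.2 v.2 w.2
          - (ε * (v.1 * w.1)) • (fderiv ℝ q z.2 a.2 • gradCoord H q z.2
            + q z.2 • fderiv ℝ (gradCoord H q) z.2 a.2)) := by
  have hq2 : DifferentiableAt ℝ (fderiv ℝ q) z.2 :=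
    (hq.fderiv_right (m := 1) (by norm_num)).differentiableAt (by norm_num)
  have hev : ∀ᶠ p in 𝓝 z, christoffel (staticCoord ε q H) p v w =
      ((fderiv ℝ q p.2 v.2 * w.1 + fderiv ℝ q p.2 w.2 * v.1) * (q p.2)⁻¹,
        christoffel H p.2 v.2 w.2 - (q p.2 * (ε * (v.1 * w.1))) • gradCoord H q p.2) := by
    filter_upwards [continuousAt_snd.eventually hH.eventually,
      continuousAt_snd.eventually (hq.eventually (by decide)),
      continuousAt_snd.eventually (hq.continuousAt.eventually_ne h0)] with p h1 h2 h3
    rw [← div_eq_mul_inv]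
    exact christoffel_staticCoord h1 h2 h3 hε v w
  have h1 : HasFDerivAt (fun p : ℝ × F => q p.2) _ z :=
    (hq.differentiableAt (by norm_num)).hasFDerivAt.comp z hasFDerivAt_snd
  have h1' : HasFDerivAt (fun p : ℝ × F => (q p.2)⁻¹) _ z :=
    (hasDerivAt_inv h0).comp_hasFDerivAt z h1
  have h2 : ∀ b : F, HasFDerivAt (fun p : ℝ × F => fderiv ℝ q p.2 b)
      (((fderiv ℝ (fderiv ℝ q) z.2).flip b).comp (ContinuousLinearMap.snd ℝ ℝ F)) z := by
    intro b
    refine ((hq2.hasFDerivAt.comp z hasFDerivAt_snd).clm_apply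
      (hasFDerivAt_const b z)).congr_fderiv ?_
    ext <;> simp
  have h3 : HasFDerivAt (fun p : ℝ × F =>
      (fderiv ℝ q p.2 v.2 * w.1 + fderiv ℝ q p.2 w.2 * v.1) * (q p.2)⁻¹) _ z :=
    (((h2 v.2).mul_const w.1).add ((h2 w.2).mul_const v.1)).mul h1'
  have h4 : HasFDerivAt (fun p : ℝ × F => christoffel H p.2 v.2 w.2) _ z :=
    (hH.hasFDerivAt_christoffel_apply v.2 w.2).comp z hasFDerivAt_snd
  have h5 : HasFDerivAt (fun p : ℝ × F => gradCoord H q p.2) _ z :=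
    (hH.differentiableAt_gradCoord hq).hasFDerivAt.comp z hasFDerivAt_snd
  refine (hH.staticCoord hq h0 hε).fderiv_christoffel_apply hev
    (h3.prodMk (h4.sub ((h1.mul_const (ε * (v.1 * w.1))).smul h5))) ?_
  refine Prod.ext ?_ ?_
  · simp
    field_simp
    ring
  · simp
    module

theorem ricciCoord_staticCoord (hH : IsCoordMetricAt H z.2) (hq : ContDiffAt ℝ 2 q z.2)
    (h0 : q z.2 ≠ 0) (hε : ε ≠ 0) (v w : ℝ × F) :
    ricciCoord (staticCoord ε q H) z v w =
      ricciCoord H z.2 v.2 w.2 - hessianCoord H q z.2 v.2 w.2 / q z.2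
        - ε * (v.1 * w.1) * (q z.2 * laplacianCoord H q z.2) := by
  let A : F →ₗ[ℝ] F := (curvatureEnd H z.2 v.2 w.2 : F →ₗ[ℝ] F)
    - (ε * (v.1 * w.1) * q z.2) •
      ((H z.2).inverse ∘L hessianCoord H q z.2 : F →L[ℝ] F).toLinearMap
  have hA : ∀ a, (curvatureEnd (staticCoord ε q H) z v w (0, a)).2 = A a := by
    intro a
    simp only [A, LinearMap.sub_apply, LinearMap.smul_apply, ContinuousLinearMap.coe_coe,
      ← hH.fderiv_gradCoord_add hq]
    simp only [curvatureEnd_apply, fderiv_christoffel_staticCoord hH hq h0 hε,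
      christoffel_staticCoord hH hq h0 hε]
    simp
    match_scalars <;> field_simp
    ring
  have h1 : (curvatureEnd (staticCoord ε q H) z v w (1, 0)).1 =
      -(hessianCoord H q z.2 v.2 w.2 / q z.2) := by
    simp only [curvatureEnd_apply, fderiv_christoffel_staticCoord hH hq h0 hε,
      christoffel_staticCoord hH hq h0 hε, hessianCoord_apply]
    simp
    field_simp
    ring
  rw [ricciCoord, LinearMap.trace_real_prod_eq _ A hA]
  simp only [A, map_sub, map_smul]
  rw [ContinuousLinearMap.coe_coe, h1, ricciCoord, laplacianCoord]
  simp
  ring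

end StaticCoordinates

section Germs

open PseudoRiem Topology

variable {E : Type*} [NormedAddCommGroup E] [NormedSpace ℝ E]
  {G G' : E → E →L[ℝ] E →L[ℝ] ℝ} {y : E}

theorem christoffel_congr (h : G =ᶠ[𝓝 y] G') : christoffel G y = christoffel G' y := by
  ext v w
  rw [christoffel_apply, christoffel_apply, h.eq_of_nhds]
  congr 1
  ext z
  rw [christoffelLow_apply, christoffelLow_apply, h.fderiv_eq]

theorem ricciCoord_congr (h : G =ᶠ[𝓝 y] G') (v w : E) : ricciCoord G y v w = ricciCoord G' y v w := by
  have h1 : christoffel G =ᶠ[𝓝 y] christoffel G' := by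
    filter_upwards [h.eventually_nhds] with z hz using christoffel_congr hz
  rw [ricciCoord, ricciCoord]
  congr 2
  ext a
  rw [curvatureEnd_apply, curvatureEnd_apply, h1.fderiv_eq, h1.eq_of_nhds]

theorem hessianCoord_congr (h : G =ᶠ[𝓝 y] G') (f : E → ℝ) :
    hessianCoord G f y = hessianCoord G' f y := by
  ext v w
  rw [hessianCoord_apply, hessianCoord_apply, christoffel_congr h]

theorem laplacianCoord_congr (h : G =ᶠ[𝓝 y] G') (f : E → ℝ) :
    laplacianCoord G f y = laplacianCoord G' f y := by
  rw [laplacianCoord, laplacianCoord, hessianCoord_congr h, h.eq_of_nhds]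

end Germs

section Charts

open PseudoRiem Topology

variable {E : Type*} [NormedAddCommGroup E] [NormedSpace ℝ E]
  {H : Type*} [TopologicalSpace H] {I : ModelWithCorners ℝ E H}
  {M : Type*} [TopologicalSpace M] [ChartedSpace H M]

theorem eventually_mdifferentiableAt_extChartAt_symm [I.Boundaryless] [IsManifold I 1 M] (p : M) :
    ∀ᶠ y in 𝓝 (extChartAt I p p), MDifferentiableAt 𝓘(ℝ, E) I (extChartAt I p).symm y := by
  filter_upwards [extChartAt_target_mem_nhds (I := I) p] with y hy
  have := mdifferentiableWithinAt_extChartAt_symm (I := I) hy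
  rwa [I.range_eq_univ, mdifferentiableWithinAt_univ] at this

theorem mfderiv_extChartAt_symm_self [I.Boundaryless] [IsManifold I 1 M] (p : M) :
    (mfderiv 𝓘(ℝ, E) I (extChartAt I p).symm (extChartAt I p p) : E →L[ℝ] E) =
      ContinuousLinearMap.id ℝ E := by
  have h := (eventually_mdifferentiableAt_extChartAt_symm (I := I) p).self_of_nhds
  refine h.mfderiv.trans ?_
  simp only [writtenInExtChartAt, extChartAt_to_inv, extChartAt_model_space_eq_id,
    modelWithCornersSelf_coe, Set.range_id, fderivWithin_univ, PartialEquiv.refl_symm,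
    PartialEquiv.refl_coe, Function.comp_id, id_eq]
  have h2 : (extChartAt I p ∘ (extChartAt I p).symm) =ᶠ[𝓝 (extChartAt I p p)] id := by
    filter_upwards [extChartAt_target_mem_nhds (I := I) p] with y hy
    exact (extChartAt I p).right_inv hy
  rw [h2.fderiv_eq, fderiv_id]

theorem inChart_self [I.Boundaryless] [IsManifold I 1 M] (g : BilinField I M) (p : M) :
    g.inChart p (extChartAt I p p) = g p := by
  have h := mfderiv_extChartAt_symm_self (I := I) p
  have h2 : (extChartAt I p).symm (extChartAt I p p) = p := extChartAt_to_inv p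
  ext v w
  change g ((extChartAt I p).symm (extChartAt I p p))
    ((mfderiv 𝓘(ℝ, E) I (extChartAt I p).symm (extChartAt I p p) : E →L[ℝ] E) v)
    ((mfderiv 𝓘(ℝ, E) I (extChartAt I p).symm (extChartAt I p p) : E →L[ℝ] E) w) = g p v w
  rw [h, h2]
  rfl

theorem PseudoRiem.IsMetricOn.inChart_symm {r : WithTop ℕ∞} {g : BilinField I M}
    (hg : IsMetricOn r g Set.univ) (p : M) (y v w : E) :
    g.inChart p y v w = g.inChart p y w v :=
  hg.symmetric ((extChartAt I p).symm y) (Set.mem_univ _)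
    ((mfderiv 𝓘(ℝ, E) I (extChartAt I p).symm y : E →L[ℝ] E) v)
    ((mfderiv 𝓘(ℝ, E) I (extChartAt I p).symm y : E →L[ℝ] E) w)

theorem PseudoRiem.IsMetricOn.isInvertible_inChart [FiniteDimensional ℝ E] [I.Boundaryless]
    [IsManifold I 1 M] {r : WithTop ℕ∞} {g : BilinField I M} (hg : IsMetricOn r g Set.univ)
    (p : M) : (g.inChart p (extChartAt I p p)).IsInvertible := by
  refine ContinuousLinearMap.isInvertible_of_nondegenerate _ fun v hv => ?_
  rw [inChart_self] at hv
  exact hg.nondegenerate p (Set.mem_univ _) v hv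

theorem PseudoRiem.IsMetricOn.isCoordMetricAt [FiniteDimensional ℝ E] [I.Boundaryless]
    [IsManifold I 1 M] {r : WithTop ℕ∞} (hr : 2 ≤ r) {g : BilinField I M}
    (hg : IsMetricOn r g Set.univ) (p : M) :
    IsCoordMetricAt (g.inChart p) (extChartAt I p p) :=
  ⟨(hg.contDiff p (Set.mem_univ _)).of_le hr, Filter.Eventually.of_forall (hg.inChart_symm p),
    hg.isInvertible_inChart p⟩

theorem extChartAt_line_prod_self (x : ℝ) (p : M) :
    extChartAt (𝓘(ℝ, ℝ).prod I) (x, p) (x, p) = (x, extChartAt I p p) := by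
  rw [extChartAt_prod, extChartAt_model_space_eq_id]
  rfl

theorem extChartAt_line_prod_symm (x : ℝ) (p : M) (y : ℝ × E) :
    (extChartAt (𝓘(ℝ, ℝ).prod I) (x, p)).symm y = (y.1, (extChartAt I p).symm y.2) := by
  rw [extChartAt_prod, extChartAt_model_space_eq_id]
  rfl

theorem hasMFDerivAt_extChartAt_symm_line_prod {p : M} {y : ℝ × E} (x : ℝ)
    (h : MDifferentiableAt 𝓘(ℝ, E) I (extChartAt I p).symm y.2) :
    HasMFDerivAt 𝓘(ℝ, ℝ × E) (𝓘(ℝ, ℝ).prod I) (extChartAt (𝓘(ℝ, ℝ).prod I) (x, p)).symm y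
      ((ContinuousLinearMap.fst ℝ ℝ E).prod
        ((mfderiv 𝓘(ℝ, E) I (extChartAt I p).symm y.2 : E →L[ℝ] E) ∘L
          ContinuousLinearMap.snd ℝ ℝ E)) := by
  have h1 : HasMFDerivAt 𝓘(ℝ, ℝ × E) 𝓘(ℝ, ℝ) (Prod.fst : ℝ × E → ℝ) y
      (ContinuousLinearMap.fst ℝ ℝ E) := hasFDerivAt_fst.hasMFDerivAt
  have h2 : HasMFDerivAt 𝓘(ℝ, ℝ × E) 𝓘(ℝ, E) (Prod.snd : ℝ × E → E) y
      (ContinuousLinearMap.snd ℝ ℝ E) := hasFDerivAt_snd.hasMFDerivAt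
  have h3 := h1.prodMk (HasMFDerivAt.comp y h.hasMFDerivAt h2)
  have h4 : ((extChartAt (𝓘(ℝ, ℝ).prod I) (x, p)).symm : ℝ × E → ℝ × M) =
      fun z => (z.1, (extChartAt I p).symm z.2) :=
    funext (extChartAt_line_prod_symm x p)
  rw [h4]
  exact h3

theorem eventually_mdifferentiableAt_extChartAt_symm_line_prod {p : M} (x : ℝ)
    (h : ∀ᶠ y in 𝓝 (extChartAt I p p), MDifferentiableAt 𝓘(ℝ, E) I (extChartAt I p).symm y) :
    ∀ᶠ y in 𝓝 (x, extChartAt I p p), MDifferentiableAt 𝓘(ℝ, ℝ × E) (𝓘(ℝ, ℝ).prod I)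
      (extChartAt (𝓘(ℝ, ℝ).prod I) (x, p)).symm y := by
  filter_upwards [(continuousAt_snd (p := (x, extChartAt I p p))).eventually h] with y hy
  exact (hasMFDerivAt_extChartAt_symm_line_prod x hy).mdifferentiableAt

theorem inChart_line_prod {p : M} {y : ℝ × E} (x : ℝ)
    (h : MDifferentiableAt 𝓘(ℝ, E) I (extChartAt I p).symm y.2)
    (g : BilinField (𝓘(ℝ, ℝ).prod I) (ℝ × M)) (v w : ℝ × E) :
    g.inChart (x, p) y v w = g (y.1, (extChartAt I p).symm y.2)
      ((v.1, (mfderiv 𝓘(ℝ, E) I (extChartAt I p).symm y.2 : E →L[ℝ] E) v.2) : ℝ × E)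
      ((w.1, (mfderiv 𝓘(ℝ, E) I (extChartAt I p).symm y.2 : E →L[ℝ] E) w.2) : ℝ × E) := by
  have h1 := (hasMFDerivAt_extChartAt_symm_line_prod x h).mfderiv
  change g ((extChartAt (𝓘(ℝ, ℝ).prod I) (x, p)).symm y)
    ((mfderiv 𝓘(ℝ, ℝ × E) (𝓘(ℝ, ℝ).prod I)
      (extChartAt (𝓘(ℝ, ℝ).prod I) (x, p)).symm y : (ℝ × E) →L[ℝ] (ℝ × E)) v)
    ((mfderiv 𝓘(ℝ, ℝ × E) (𝓘(ℝ, ℝ).prod I)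
      (extChartAt (𝓘(ℝ, ℝ).prod I) (x, p)).symm y : (ℝ × E) →L[ℝ] (ℝ × E)) w) = _
  rw [h1, extChartAt_line_prod_symm]
  rfl

theorem warpedOverLine_apply (u : ℝ → ℝ) (g : BilinField I M) (z : ℝ × M) (v w : ℝ × E) :
    warpedOverLine u g z v w =
      v.1 * w.1 + u z.1 ^ 2 * (g z.2 : E →L[ℝ] E →L[ℝ] ℝ) v.2 w.2 := by
  refine (orthSum_apply _ _ v w).trans ?_
  congr 1
  exact one_mul _

theorem iteratedWarped_apply (ε : ℝ) (u : ℝ → ℝ) (g : BilinField I M) (z : ℝ × (ℝ × M))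
    (v w : ℝ × (ℝ × E)) :
    iteratedWarped ε u g z v w = ε * deriv u z.2.1 ^ 2 * (v.1 * w.1)
      + (warpedOverLine u g z.2 : (ℝ × E) →L[ℝ] (ℝ × E) →L[ℝ] ℝ) v.2 w.2 :=
  orthSum_apply _ _ v w

theorem inChart_warpedOverLine {p : M} (u : ℝ → ℝ) (g : BilinField I M) (x : ℝ)
    (h : ∀ᶠ y in 𝓝 (extChartAt I p p), MDifferentiableAt 𝓘(ℝ, E) I (extChartAt I p).symm y) :
    (warpedOverLine u g).inChart (x, p) =ᶠ[𝓝 (x, extChartAt I p p)]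
      warpedCoord u (g.inChart p) := by
  filter_upwards [(continuousAt_snd (p := (x, extChartAt I p p))).eventually h] with y hy
  refine ContinuousLinearMap.ext fun v => ContinuousLinearMap.ext fun w => ?_
  rw [inChart_line_prod x hy, warpedCoord_apply, warpedOverLine_apply]
  rfl

theorem inChart_iteratedWarped {p : M} (ε : ℝ) (u : ℝ → ℝ) (g : BilinField I M) (t x : ℝ)
    (h : ∀ᶠ y in 𝓝 (extChartAt I p p), MDifferentiableAt 𝓘(ℝ, E) I (extChartAt I p).symm y) :
    (iteratedWarped ε u g).inChart (t, (x, p)) =ᶠ[𝓝 (t, (x, extChartAt I p p))]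
      staticCoord ε (fun z : ℝ × E => deriv u z.1) (warpedCoord u (g.inChart p)) := by
  have h1 := eventually_mdifferentiableAt_extChartAt_symm_line_prod x h
  filter_upwards [(continuousAt_snd (p := (t, (x, extChartAt I p p)))).eventually h1,
    (continuousAt_snd (p := (t, (x, extChartAt I p p)))).eventually (inChart_warpedOverLine u g x h)]
    with y hy hy2
  refine ContinuousLinearMap.ext fun v => ContinuousLinearMap.ext fun w => ?_
  rw [inChart_line_prod t hy, staticCoord_apply, ← hy2, iteratedWarped_apply,
    extChartAt_line_prod_symm]
  rfl

theorem comp_fst_extChartAt_symm (f : ℝ → ℝ) (x : ℝ) (p : M) :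
    ((fun z : ℝ × M => f z.1) ∘ (extChartAt (𝓘(ℝ, ℝ).prod I) (x, p)).symm : ℝ × E → ℝ) =
      fun y => f y.1 := by
  funext y
  rw [Function.comp_apply, extChartAt_line_prod_symm]

theorem ricci_line_prod (G : BilinField (𝓘(ℝ, ℝ).prod I) (ℝ × M)) (x : ℝ) (p : M) (v w : ℝ × E) :
    ricci G (x, p) v w = ricciCoord (G.inChart (x, p)) (x, extChartAt I p p) v w := by
  change ricciCoord (G.inChart (x, p)) (extChartAt (𝓘(ℝ, ℝ).prod I) (x, p) (x, p)) v w = _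
  rw [extChartAt_line_prod_self]

theorem hessian_line_prod (G : BilinField (𝓘(ℝ, ℝ).prod I) (ℝ × M)) (f : ℝ → ℝ) (x : ℝ) (p : M)
    (v w : ℝ × E) :
    hessian G (fun z : ℝ × M => f z.1) (x, p) v w =
      hessianCoord (G.inChart (x, p)) (fun y : ℝ × E => f y.1) (x, extChartAt I p p) v w := by
  change hessianCoord (G.inChart (x, p)) ((fun z : ℝ × M => f z.1) ∘
    (extChartAt (𝓘(ℝ, ℝ).prod I) (x, p)).symm) (extChartAt (𝓘(ℝ, ℝ).prod I) (x, p) (x, p)) v w = _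
  rw [extChartAt_line_prod_self, comp_fst_extChartAt_symm]

theorem laplacian_line_prod (G : BilinField (𝓘(ℝ, ℝ).prod I) (ℝ × M)) (f : ℝ → ℝ) (x : ℝ) (p : M) :
    laplacian G (fun z : ℝ × M => f z.1) (x, p) =
      laplacianCoord (G.inChart (x, p)) (fun y : ℝ × E => f y.1) (x, extChartAt I p p) := by
  rw [laplacian, extChartAt_line_prod_self, comp_fst_extChartAt_symm]

section Metric

variable [I.Boundaryless] [IsManifold I 1 M] {r : WithTop ℕ∞}
  {g : BilinField I M} {u : ℝ → ℝ} {x : ℝ}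

theorem isMetricOn_iteratedWarped (hg : IsMetricOn r g Set.univ) {J : Set ℝ} (hJ : IsOpen J)
    (hu : ContDiffOn ℝ (r + 1) u J) (h0 : ∀ x ∈ J, u x ≠ 0) (h1 : ∀ x ∈ J, deriv u x ≠ 0)
    {ε : ℝ} (hε : ε ≠ 0) :
    IsMetricOn r (iteratedWarped ε u g) (Set.univ ×ˢ (J ×ˢ Set.univ)) where
  symmetric := by
    rintro ⟨t, x, p⟩ - v w
    refine (iteratedWarped_apply ε u g _ v w).trans
      (Eq.trans ?_ (iteratedWarped_apply ε u g _ w v).symm)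
    rw [warpedOverLine_apply, warpedOverLine_apply,
      show (g p : E →L[ℝ] E →L[ℝ] ℝ) v.2.2 w.2.2 = (g p : E →L[ℝ] E →L[ℝ] ℝ) w.2.2 v.2.2 from
        hg.symmetric p (Set.mem_univ _) v.2.2 w.2.2]
    ring
  nondegenerate := by
    rintro ⟨t, x, p⟩ ⟨-, hx, -⟩ (v : ℝ × (ℝ × E)) hv
    obtain ⟨B, hB⟩ : ∃ B : E →L[ℝ] E →L[ℝ] ℝ, B = g p := ⟨_, rfl⟩
    have key : ∀ w : ℝ × (ℝ × E), ε * deriv u x ^ 2 * (v.1 * w.1) + (v.2.1 * w.2.1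
        + u x ^ 2 * B v.2.2 w.2.2) = 0 := fun w => by
      rw [hB, ← hv w]
      refine Eq.symm ((iteratedWarped_apply ε u g _ v w).trans ?_)
      rw [warpedOverLine_apply]
      rfl
    have e1 : v.1 = 0 := by simpa [hε, h1 x hx] using key (1, 0, 0)
    have e2 : v.2.1 = 0 := by simpa using key (0, 1, 0)
    have e3 : v.2.2 = 0 := hg.nondegenerate p (Set.mem_univ _) v.2.2 fun w => by
      rw [← hB]
      have h3 := key (0, 0, w)
      simp only [mul_zero, zero_add, mul_eq_zero, pow_eq_zero_iff two_ne_zero, h0 x hx,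
        false_or] at h3
      exact h3
    exact Prod.ext e1 (Prod.ext e2 e3)
  contDiff := by
    rintro ⟨t, x, p⟩ ⟨-, hx, -⟩
    have hux : ContDiffAt ℝ (r + 1) u x := hu.contDiffAt (hJ.mem_nhds hx)
    rw [extChartAt_line_prod_self, extChartAt_line_prod_self]
    refine ContDiffAt.congr_of_eventuallyEq ?_ (inChart_iteratedWarped ε u g t x
      (eventually_mdifferentiableAt_extChartAt_symm p))
    refine ContDiffAt.staticCoord (z := (t, (x, extChartAt I p p))) ?_ ?_
    · exact ContDiffAt.comp (x, extChartAt I p p) (hux.derivWithin (m := r) le_rfl)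
        contDiffAt_fst
    · exact ContDiffAt.warpedCoord (z := (x, extChartAt I p p))
        (hux.of_le le_self_add) (hg.contDiff p (Set.mem_univ _))

variable [FiniteDimensional ℝ E]

theorem isCoordMetricAt_warpedCoord (hr : 2 ≤ r) (hg : IsMetricOn r g Set.univ)
    (hu : ContDiffAt ℝ 2 u x) (h0 : u x ≠ 0) (p : M) :
    IsCoordMetricAt (warpedCoord u (g.inChart p)) (x, extChartAt I p p) :=
  IsCoordMetricAt.warpedCoord (z := (x, extChartAt I p p)) (hg.isCoordMetricAt hr p) hu h0

theorem ricci_warpedOverLine (hr : 2 ≤ r) (hg : IsMetricOn r g Set.univ)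
    (hu : ContDiffAt ℝ 2 u x) (h0 : u x ≠ 0) (p : M) (v w : ℝ × E) :
    ricci (warpedOverLine u g) (x, p) v w =
      ricci g p v.2 w.2
        - Module.finrank ℝ E * (deriv (deriv u) x / u x) * (v.1 * w.1)
        - (u x * deriv (deriv u) x + (Module.finrank ℝ E - 1) * deriv u x ^ 2)
          * (g p : E →L[ℝ] E →L[ℝ] ℝ) v.2 w.2 := by
  rw [ricci_line_prod, ricciCoord_congr (inChart_warpedOverLine u g x
    (eventually_mdifferentiableAt_extChartAt_symm p)),
    ricciCoord_warpedCoord (z := (x, extChartAt I p p)) (hg.isCoordMetricAt hr p) hu h0,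
    inChart_self]
  rfl

theorem hessian_warpedOverLine (hr : 2 ≤ r) (hg : IsMetricOn r g Set.univ)
    (hu : ContDiffAt ℝ 2 u x) (h0 : u x ≠ 0) {f : ℝ → ℝ} (hf : ContDiffAt ℝ 2 f x) (p : M)
    (v w : ℝ × E) :
    hessian (warpedOverLine u g) (fun z : ℝ × M => f z.1) (x, p) v w =
      deriv (deriv f) x * (v.1 * w.1)
        + deriv f x * (u x * deriv u x) * (g p : E →L[ℝ] E →L[ℝ] ℝ) v.2 w.2 := by
  rw [hessian_line_prod,
    hessianCoord_congr (inChart_warpedOverLine u g x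
      (eventually_mdifferentiableAt_extChartAt_symm p)),
    hessianCoord_warpedCoord (z := (x, extChartAt I p p)) (hg.isCoordMetricAt hr p) hu h0 hf,
    inChart_self]
  rfl

theorem laplacian_warpedOverLine (hr : 2 ≤ r) (hg : IsMetricOn r g Set.univ)
    (hu : ContDiffAt ℝ 2 u x) (h0 : u x ≠ 0) {f : ℝ → ℝ} (hf : ContDiffAt ℝ 2 f x) (p : M) :
    laplacian (warpedOverLine u g) (fun z : ℝ × M => f z.1) (x, p) =
      deriv (deriv f) x + Module.finrank ℝ E * (deriv f x * deriv u x / u x) := by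
  rw [laplacian_line_prod, laplacianCoord_congr (inChart_warpedOverLine u g x
      (eventually_mdifferentiableAt_extChartAt_symm p)),
    laplacianCoord_warpedCoord (z := (x, extChartAt I p p)) (hg.isCoordMetricAt hr p) hu h0 hf]

theorem ricci_iteratedWarped (hr : 2 ≤ r) (hg : IsMetricOn r g Set.univ)
    (hu : ContDiffAt ℝ 3 u x) (h0 : u x ≠ 0) (h1 : deriv u x ≠ 0) {ε : ℝ} (hε : ε ≠ 0) (t : ℝ)
    (p : M) (v w : ℝ × (ℝ × E)) :
    ricci (iteratedWarped ε u g) (t, (x, p)) v w =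
      ricci (warpedOverLine u g) (x, p) v.2 w.2
        - hessian (warpedOverLine u g) (fun z : ℝ × M => deriv u z.1) (x, p) v.2 w.2 / deriv u x
        - ε * (v.1 * w.1) * (deriv u x *
          laplacian (warpedOverLine u g) (fun z : ℝ × M => deriv u z.1) (x, p)) := by
  have hM := eventually_mdifferentiableAt_extChartAt_symm (I := I) p
  have hu2 : ContDiffAt ℝ 2 u x := hu.of_le (by norm_num)
  have hq : ContDiffAt ℝ 2 (fun z : ℝ × E => deriv u z.1) (x, extChartAt I p p) :=
    ContDiffAt.comp (x, extChartAt I p p) (hu.derivWithin (m := 2) (by norm_num)) contDiffAt_fst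
  rw [ricci_line_prod, extChartAt_line_prod_self,
    ricciCoord_congr (inChart_iteratedWarped ε u g t x hM),
    ricciCoord_staticCoord (z := (t, (x, extChartAt I p p)))
      (isCoordMetricAt_warpedCoord hr hg hu2 h0 p) hq h1 hε,
    ricci_line_prod, hessian_line_prod, laplacian_line_prod,
    ricciCoord_congr (inChart_warpedOverLine u g x hM),
    hessianCoord_congr (inChart_warpedOverLine u g x hM),
    laplacianCoord_congr (inChart_warpedOverLine u g x hM)]

end Metric

end Charts

section LinearODE

open Topology Set

/-- A solution of a homogeneous linear second order equation on an open interval that vanishes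
to first order at a point is zero. -/
theorem eqOn_zero_of_linear_second_order {J : Set ℝ} (hJo : IsOpen J) (hJc : IsPreconnected J)
    {α β v v' v'' : ℝ → ℝ} (hα : ContinuousOn α J) (hβ : ContinuousOn β J)
    (hv : ∀ x ∈ J, HasDerivAt v (v' x) x) (hv' : ∀ x ∈ J, HasDerivAt v' (v'' x) x)
    (hode : ∀ x ∈ J, v'' x = α x * v x + β x * v' x) {x₀ : ℝ} (hx₀ : x₀ ∈ J)
    (h0 : v x₀ = 0) (h0' : v' x₀ = 0) : ∀ x ∈ J, v x = 0 := by
  let Z : Set ℝ := {x | v x = 0 ∧ v' x = 0}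
  have hpair : ∀ x ∈ J, HasDerivAt (fun t => (v t, v' t)) (v' x, v'' x) x := fun x hx =>
    (hv x hx).prodMk (hv' x hx)
  have hloc : ∀ x ∈ J, x ∈ Z → ∀ᶠ t in 𝓝 x, t ∈ Z := by
    intro x hx hxZ
    let A : ℝ → ℝ × ℝ → ℝ × ℝ := fun t y => (y.2, α t * y.1 + β t * y.2)
    have hα' := (hα.continuousAt (hJo.mem_nhds hx)).norm
    have hβ' := (hβ.continuousAt (hJo.mem_nhds hx)).norm
    let K : NNReal := ⟨1 + (‖α x‖ + 1) + (‖β x‖ + 1), by positivity⟩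
    have hLip : ∀ᶠ t in 𝓝 x, LipschitzOnWith K (A t) univ := by
      filter_upwards [hα'.eventually_lt_const (lt_add_one ‖α x‖),
        hβ'.eventually_lt_const (lt_add_one ‖β x‖)] with t h1 h2
      refine LipschitzOnWith.of_dist_le_mul fun y _ z _ => ?_
      rw [dist_eq_norm, dist_eq_norm]
      have e1 : ‖(y - z).1‖ ≤ ‖y - z‖ := norm_fst_le _
      have e2 : ‖(y - z).2‖ ≤ ‖y - z‖ := norm_snd_le _
      have e3 : A t y - A t z = ((y - z).2, α t * (y - z).1 + β t * (y - z).2) := by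
        simp only [A, Prod.mk_sub_mk, Prod.fst_sub, Prod.snd_sub]
        congr 1
        ring
      have e4 : ‖α t * (y - z).1 + β t * (y - z).2‖ ≤
          (‖α x‖ + 1) * ‖y - z‖ + (‖β x‖ + 1) * ‖y - z‖ := by
        refine (norm_add_le _ _).trans ?_
        rw [norm_mul, norm_mul]
        gcongr
      have hK : (K : ℝ) = 1 + (‖α x‖ + 1) + (‖β x‖ + 1) := rfl
      rw [e3, hK, Prod.norm_def]
      refine max_le (e2.trans ?_) (e4.trans ?_)
      · nlinarith [norm_nonneg (y - z), norm_nonneg (α x), norm_nonneg (β x),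
          mul_nonneg (norm_nonneg (α x)) (norm_nonneg (y - z)),
          mul_nonneg (norm_nonneg (β x)) (norm_nonneg (y - z))]
      · nlinarith [norm_nonneg (y - z)]
    have h1 : ∀ᶠ t in 𝓝 x, HasDerivAt (fun t => (v t, v' t)) (A t (v t, v' t)) t ∧
        (v t, v' t) ∈ (univ : Set (ℝ × ℝ)) := by
      filter_upwards [hJo.mem_nhds hx] with t ht
      refine ⟨?_, mem_univ _⟩
      simpa only [A, ← hode t ht] using hpair t ht
    have h2 : ∀ᶠ t in 𝓝 x, HasDerivAt (fun _ => (0 : ℝ × ℝ)) (A t 0) t ∧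
        (0 : ℝ × ℝ) ∈ (univ : Set (ℝ × ℝ)) :=
      Filter.Eventually.of_forall fun t => ⟨by
        have : A t 0 = 0 := by simp [A]
        rw [this]
        exact hasDerivAt_const t _, mem_univ _⟩
    filter_upwards [ODE_solution_unique_of_eventually (s := fun _ => univ) hLip h1 h2
      (Prod.ext hxZ.1 hxZ.2)] with t ht
    exact ⟨congrArg Prod.fst ht, congrArg Prod.snd ht⟩
  have hsub : J ⊆ interior Z := by
    refine hJc.subset_of_closure_inter_subset isOpen_interior
      ⟨x₀, hx₀, mem_interior_iff_mem_nhds.2 (hloc x₀ hx₀ ⟨h0, h0'⟩)⟩ ?_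
    rintro x ⟨hxc, hx⟩
    refine mem_interior_iff_mem_nhds.2 (hloc x hx ?_)
    have hc : ContinuousAt (fun t => (v t, v' t)) x := (hpair x hx).continuousAt
    have hmem := hc.continuousWithinAt.mem_closure_image (closure_mono interior_subset hxc)
    have himg : (fun t => (v t, v' t)) '' Z ⊆ {0} := by
      rintro _ ⟨t, ht, rfl⟩
      exact Prod.ext ht.1 ht.2
    have := closure_mono himg hmem
    rw [closure_singleton] at this
    exact ⟨congrArg Prod.fst this, congrArg Prod.snd this⟩
  exact fun x hx => (interior_subset (hsub hx)).1

/-- If `f` solves a homogeneous linear second order equation, is not identically zero, and has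
vanishing Wronskian with `w`, then `w` is a constant multiple of `f`. -/
theorem exists_eq_mul_of_wronskian_eq_zero {J : Set ℝ} (hJo : IsOpen J) (hJc : IsPreconnected J)
    {α β f f' f'' w w' w'' : ℝ → ℝ} (hα : ContinuousOn α J) (hβ : ContinuousOn β J)
    (hf : ∀ x ∈ J, HasDerivAt f (f' x) x) (hf' : ∀ x ∈ J, HasDerivAt f' (f'' x) x)
    (hw : ∀ x ∈ J, HasDerivAt w (w' x) x) (hw' : ∀ x ∈ J, HasDerivAt w' (w'' x) x)
    (hw'' : ContinuousOn w'' J)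
    (hode : ∀ x ∈ J, f'' x = α x * f x + β x * f' x)
    (hW : ∀ x ∈ J, f' x * w x = f x * w' x) (hne : ∃ x ∈ J, f x ≠ 0) :
    ∃ c : ℝ, ∀ x ∈ J, w x = c * f x := by
  obtain ⟨x₀, hx₀, hfx₀⟩ := hne
  have hzero : ∀ x ∈ J, f x = 0 → f' x ≠ 0 := fun x hx h1 h2 =>
    hfx₀ (eqOn_zero_of_linear_second_order hJo hJc hα hβ hf hf' hode hx h1 h2 x₀ hx₀)
  have hnz : ∀ x ∈ J, f x ≠ 0 → w'' x = α x * w x + β x * w' x := by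
    intro x hx hfx
    have h1 : HasDerivAt (fun t => f' t * w t - f t * w' t) _ x :=
      ((hf' x hx).mul (hw x hx)).sub ((hf x hx).mul (hw' x hx))
    have h2 : HasDerivAt (fun t => f' t * w t - f t * w' t) 0 x :=
      (hasDerivAt_const x (0 : ℝ)).congr_of_eventuallyEq (by
        filter_upwards [hJo.mem_nhds hx] with t ht
        rw [hW t ht, sub_self])
    have h3 := h1.unique h2
    rw [hode x hx] at h3
    apply mul_left_cancel₀ hfx
    linear_combination -h3 + β x * hW x hx
  have hode_w : ∀ x ∈ J, w'' x = α x * w x + β x * w' x := by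
    intro x hx
    by_cases hfx : f x = 0
    · have hJx := hJo.mem_nhds hx
      have hcL : Filter.Tendsto w'' (𝓝[≠] x) (𝓝 (w'' x)) :=
        (hw''.continuousAt hJx).tendsto.mono_left nhdsWithin_le_nhds
      have hcR : Filter.Tendsto (fun t => α t * w t + β t * w' t) (𝓝[≠] x)
          (𝓝 (α x * w x + β x * w' x)) :=
        (((hα.continuousAt hJx).mul (hw x hx).continuousAt).add
          ((hβ.continuousAt hJx).mul (hw' x hx).continuousAt)).tendsto.mono_left
            nhdsWithin_le_nhds
      refine tendsto_nhds_unique (hcL.congr' ?_) hcR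
      filter_upwards [(hf x hx).eventually_ne (c := 0) (hzero x hx hfx),
        nhdsWithin_le_nhds hJx] with t h1 h2
      exact hnz t h2 h1
    · exact hnz x hx hfx
  refine ⟨w x₀ / f x₀, fun x hx => ?_⟩
  have := eqOn_zero_of_linear_second_order hJo hJc hα hβ
    (v := fun t => w t - w x₀ / f x₀ * f t) (v' := fun t => w' t - w x₀ / f x₀ * f' t)
    (v'' := fun t => w'' t - w x₀ / f x₀ * f'' t)
    (fun t ht => (hw t ht).sub ((hf t ht).const_mul _))
    (fun t ht => (hw' t ht).sub ((hf' t ht).const_mul _))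
    (fun t ht => by rw [hode t ht, hode_w t ht]; ring) hx₀ (by field_simp; ring)
    (by field_simp; linear_combination -hW x₀ hx₀) x hx
  exact sub_eq_zero.1 this

end LinearODE

section EinsteinStatic

open PseudoRiem Topology

variable {E : Type*} [NormedAddCommGroup E] [NormedSpace ℝ E] [FiniteDimensional ℝ E]
  {H : Type*} [TopologicalSpace H] {I : ModelWithCorners ℝ E H} [I.Boundaryless]
  {M : Type*} [TopologicalSpace M] [ChartedSpace H M] [IsManifold I 1 M]
  {r : WithTop ℕ∞} {g : BilinField I M} {u f : ℝ → ℝ} {J : Set ℝ} {κ : ℝ}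

/-- The static equation on `dx² + u² g` for a function of `x`, when `g` is Einstein. -/
theorem staticEquationOn_warpedOverLine_iff [Nonempty M] [Nontrivial E] (hr : 2 ≤ r)
    (hg : IsEinsteinOn r g Set.univ κ) (hJ : IsOpen J) (hu : ContDiffOn ℝ 2 u J)
    (h0 : ∀ x ∈ J, u x ≠ 0) (hf : ContDiffOn ℝ 2 f J) :
    StaticEquationOn (warpedOverLine u g) (fun z : ℝ × M => f z.1) (J ×ˢ Set.univ) ↔
      ∀ x ∈ J, deriv f x * deriv u x = f x * deriv (deriv u) x ∧
        f x * (κ - u x * deriv (deriv u) x - (Module.finrank ℝ E - 1) * deriv u x ^ 2)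
          + (Module.finrank ℝ E - 1) * (u x * deriv u x * deriv f x)
          + u x ^ 2 * deriv (deriv f) x = 0 := by
  have key : ∀ x ∈ J, ∀ (p : M) (v w : ℝ × E),
      f x * ricci (warpedOverLine u g) (x, p) v w
        - hessian (warpedOverLine u g) (fun z : ℝ × M => f z.1) (x, p) v w
        + laplacian (warpedOverLine u g) (fun z : ℝ × M => f z.1) (x, p)
          * (warpedOverLine u g (x, p) : (ℝ × E) →L[ℝ] (ℝ × E) →L[ℝ] ℝ) v w =
      Module.finrank ℝ E / u x * (deriv f x * deriv u x - f x * deriv (deriv u) x) * (v.1 * w.1)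
      + (f x * (κ - u x * deriv (deriv u) x - (Module.finrank ℝ E - 1) * deriv u x ^ 2)
          + (Module.finrank ℝ E - 1) * (u x * deriv u x * deriv f x)
          + u x ^ 2 * deriv (deriv f) x) * (g p : E →L[ℝ] E →L[ℝ] ℝ) v.2 w.2 := by
    intro x hx p v w
    have hux := hu.contDiffAt (hJ.mem_nhds hx)
    have hfx := hf.contDiffAt (hJ.mem_nhds hx)
    have hne := h0 x hx
    have hR : ricci g p v.2 w.2 = κ * (g p : E →L[ℝ] E →L[ℝ] ℝ) v.2 w.2 :=
      hg.2 p (Set.mem_univ _) v.2 w.2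
    rw [ricci_warpedOverLine hr hg.1 hux hne, hessian_warpedOverLine hr hg.1 hux hne hfx,
      laplacian_warpedOverLine hr hg.1 hux hne hfx, warpedOverLine_apply, hR]
    field_simp
    ring
  constructor
  · intro h x hx
    obtain ⟨p⟩ := ‹Nonempty M›
    obtain ⟨v, hv⟩ := exists_ne (0 : E)
    have hB : ∃ w, (g p : E →L[ℝ] E →L[ℝ] ℝ) v w ≠ 0 := by
      by_contra! hcon
      exact hv (hg.1.nondegenerate p (Set.mem_univ _) v hcon)
    obtain ⟨w, hw⟩ := hB
    have hpt : ∀ a b : ℝ × E, f x * ricci (warpedOverLine u g) (x, p) a b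
        - hessian (warpedOverLine u g) (fun z : ℝ × M => f z.1) (x, p) a b
        + laplacian (warpedOverLine u g) (fun z : ℝ × M => f z.1) (x, p)
          * (warpedOverLine u g (x, p) : (ℝ × E) →L[ℝ] (ℝ × E) →L[ℝ] ℝ) a b = 0 :=
      fun a b => h (x, p) ⟨hx, Set.mem_univ _⟩ a b
    have hm : (Module.finrank ℝ E : ℝ) ≠ 0 := Nat.cast_ne_zero.2 Module.finrank_pos.ne'
    have e1 := hpt (1, 0) (1, 0)
    have e2 := hpt (0, v) (0, w)
    rw [key x hx] at e1 e2
    obtain ⟨B, hBdef⟩ : ∃ B : E →L[ℝ] E →L[ℝ] ℝ, B = g p := ⟨_, rfl⟩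
    rw [← hBdef] at e1 e2 hw
    change _ + _ * B 0 0 = 0 at e1
    constructor
    · simpa [hm, h0 x hx, sub_eq_zero] using e1
    · simpa [hw] using e2
  · rintro h ⟨x, p⟩ ⟨hx, -⟩ a b
    refine (key x hx p a b).trans ?_
    rw [(h x hx).1, (h x hx).2]
    ring

/-- The metric `ε u'² dt² + dx² + u² g` is Einstein if `g` is, and if the three resulting
scalar equations hold. -/
theorem isEinsteinOn_iteratedWarped (hr : 2 ≤ r) (hg : IsEinsteinOn r g Set.univ κ)
    (hJ : IsOpen J) (hu : ContDiffOn ℝ (r + 1) u J) (h0 : ∀ x ∈ J, u x ≠ 0)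
    (h1 : ∀ x ∈ J, deriv u x ≠ 0) {ε : ℝ} (hε : ε ≠ 0) {c : ℝ}
    (hc : ∀ x ∈ J, c = -(deriv (deriv (deriv u)) x / deriv u x
      + Module.finrank ℝ E * (deriv (deriv u) x / u x)))
    (hc' : ∀ x ∈ J, c * u x ^ 2 = κ - (Module.finrank ℝ E - 1) * deriv u x ^ 2
      - 2 * (u x * deriv (deriv u) x)) :
    IsEinsteinOn r (iteratedWarped ε u g) (Set.univ ×ˢ (J ×ˢ Set.univ)) c := by
  refine ⟨isMetricOn_iteratedWarped hg.1 hJ hu h0 h1 hε, ?_⟩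
  rintro ⟨t, x, p⟩ ⟨-, hx, -⟩ (v : ℝ × (ℝ × E)) (w : ℝ × (ℝ × E))
  have hu3 : ContDiffAt ℝ 3 u x := by
    refine (hu.contDiffAt (hJ.mem_nhds hx)).of_le ?_
    have : (2 : WithTop ℕ∞) + 1 ≤ r + 1 := by gcongr
    exact le_trans (by norm_num) this
  have hu2 : ContDiffAt ℝ 2 u x := hu3.of_le (by norm_num)
  have hux : u x ≠ 0 := h0 x hx
  have hdx : deriv u x ≠ 0 := h1 x hx
  have hq : ContDiffAt ℝ 2 (deriv u) x := hu3.derivWithin (m := 2) (by norm_num)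
  have hR : ricci g p v.2.2 w.2.2 = κ * (g p : E →L[ℝ] E →L[ℝ] ℝ) v.2.2 w.2.2 :=
    hg.2 p (Set.mem_univ _) v.2.2 w.2.2
  have e1 := hc x hx
  have e2 := hc' x hx
  refine (ricci_iteratedWarped hr hg.1 hu3 hux hdx hε t p v w).trans ?_
  refine Eq.trans ?_ (congrArg (c * ·) (iteratedWarped_apply ε u g (t, x, p) v w).symm)
  rw [ricci_warpedOverLine hr hg.1 hu2 hux, hessian_warpedOverLine hr hg.1 hu2 hux hq,
    laplacian_warpedOverLine hr hg.1 hu2 hux hq, warpedOverLine_apply, hR]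
  obtain ⟨b, hb⟩ : ∃ b, b = (g p : E →L[ℝ] E →L[ℝ] ℝ) v.2.2 w.2.2 := ⟨_, rfl⟩
  simp only [← hb]
  have e3 : κ = c * u x ^ 2 + (Module.finrank ℝ E - 1) * deriv u x ^ 2
      + 2 * (u x * deriv (deriv u) x) := by rw [e2]; ring
  have e4 : deriv (deriv (deriv u)) x = -(c * deriv u x)
      - Module.finrank ℝ E * (deriv (deriv u) x * deriv u x / u x) := by
    rw [e1]
    field_simp
    ring
  rw [e3, e4]
  field_simp
  ring

end EinsteinStatic

section ScalarEquations

open Topology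

variable {u : ℝ → ℝ} {J : Set ℝ} {x : ℝ}

theorem ContDiffOn.hasDerivAt_deriv₂ (hJ : IsOpen J) (hu : ContDiffOn ℝ 2 u J) (hx : x ∈ J) :
    HasDerivAt u (deriv u x) x ∧ HasDerivAt (deriv u) (deriv (deriv u) x) x :=
  ⟨((hu.contDiffAt (hJ.mem_nhds hx)).differentiableAt (by norm_num)).hasDerivAt,
    (((hu.contDiffAt (hJ.mem_nhds hx)).derivWithin (m := 1) (by norm_num)).differentiableAt
      (by norm_num)).hasDerivAt⟩

/-- The solutions `f` of the reduced static equations are the multiples of `u'`, with `u` solving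
the third order equation. -/
theorem static_scalar_equations_iff {f : ℝ → ℝ} (hJ : IsOpen J) (hJc : IsPreconnected J)
    (hu : ContDiffOn ℝ 3 u J) (h0 : ∀ x ∈ J, u x ≠ 0) (hf : ContDiffOn ℝ 2 f J)
    (hf0 : ∃ x ∈ J, f x ≠ 0) (hu0 : ∃ x ∈ J, deriv u x ≠ 0) (κ m : ℝ) :
    (∀ x ∈ J, deriv f x * deriv u x = f x * deriv (deriv u) x ∧
      f x * (κ - u x * deriv (deriv u) x - (m - 1) * deriv u x ^ 2)
        + (m - 1) * (u x * deriv u x * deriv f x) + u x ^ 2 * deriv (deriv f) x = 0) ↔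
    (∃ a : ℝ, a ≠ 0 ∧ ∀ x ∈ J, f x = a * deriv u x) ∧
      ∀ x ∈ J, u x ^ 2 * deriv (deriv (deriv u)) x
        + (m - 2) * u x * deriv u x * deriv (deriv u) x - (m - 1) * deriv u x ^ 3
        + κ * deriv u x = 0 := by
  have hu' : ContDiffOn ℝ 2 (deriv u) J := hu.deriv_of_isOpen hJ (by norm_num)
  have hu'' : ContDiffOn ℝ 1 (deriv (deriv u)) J := hu'.deriv_of_isOpen hJ (by norm_num)
  have hu''' : ContinuousOn (deriv (deriv (deriv u))) J :=
    (hu''.deriv_of_isOpen (m := 0) hJ (by norm_num)).continuousOn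
  have hmul : ∀ a : ℝ, (∀ x ∈ J, f x = a * deriv u x) → ∀ x ∈ J,
      deriv f x = a * deriv (deriv u) x ∧
        deriv (deriv f) x = a * deriv (deriv (deriv u)) x := by
    intro a ha
    have h1 : ∀ x ∈ J, deriv f x = a * deriv (deriv u) x := fun x hx => by
      have : f =ᶠ[𝓝 x] fun t => a * deriv u t := by
        filter_upwards [hJ.mem_nhds hx] with t ht using ha t ht
      rw [this.deriv_eq]
      exact ((hu'.hasDerivAt_deriv₂ hJ hx).1.const_mul a).deriv
    refine fun x hx => ⟨h1 x hx, ?_⟩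
    have : deriv f =ᶠ[𝓝 x] fun t => a * deriv (deriv u) t := by
      filter_upwards [hJ.mem_nhds hx] with t ht using h1 t ht
    rw [this.deriv_eq]
    exact ((hu'.hasDerivAt_deriv₂ hJ hx).2.const_mul a).deriv
  constructor
  · intro h
    have hα : ContinuousOn (fun x => -(κ - u x * deriv (deriv u) x - (m - 1) * deriv u x ^ 2)
        / u x ^ 2) J :=
      (((continuousOn_const.sub (hu.continuousOn.mul hu''.continuousOn)).sub
        (continuousOn_const.mul (hu'.continuousOn.pow 2))).neg).div (hu.continuousOn.pow 2)
        fun x hx => pow_ne_zero 2 (h0 x hx)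
    have hβ : ContinuousOn (fun x => -((m - 1) * deriv u x) / u x) J :=
      ((continuousOn_const.mul hu'.continuousOn).neg).div hu.continuousOn h0
    obtain ⟨c, hc⟩ := exists_eq_mul_of_wronskian_eq_zero hJ hJc hα hβ
      (fun x hx => (hf.hasDerivAt_deriv₂ hJ hx).1) (fun x hx => (hf.hasDerivAt_deriv₂ hJ hx).2)
      (fun x hx => (hu'.hasDerivAt_deriv₂ hJ hx).1)
      (fun x hx => (hu'.hasDerivAt_deriv₂ hJ hx).2) hu'''
      (fun x hx => by
        have hx0 := h0 x hx
        field_simp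
        linear_combination (h x hx).2)
      (fun x hx => (h x hx).1) hf0
    have hc0 : c ≠ 0 := by
      rintro rfl
      obtain ⟨x, hx, hne⟩ := hu0
      exact hne (by rw [hc x hx, zero_mul])
    have ha : ∀ x ∈ J, f x = c⁻¹ * deriv u x := fun x hx => by
      rw [hc x hx, inv_mul_cancel_left₀ hc0]
    refine ⟨⟨c⁻¹, inv_ne_zero hc0, ha⟩, fun x hx => ?_⟩
    have h2 := (h x hx).2
    rw [ha x hx, (hmul _ ha x hx).1, (hmul _ ha x hx).2] at h2
    apply mul_left_cancel₀ (inv_ne_zero hc0)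
    linear_combination h2
  · rintro ⟨⟨a, -, ha⟩, h⟩ x hx
    rw [ha x hx, (hmul _ ha x hx).1, (hmul _ ha x hx).2]
    exact ⟨by ring, by linear_combination a * h x hx⟩

/-- The third order equation makes the Einstein constant independent of `x`. -/
theorem exists_einstein_constant (hJ : IsOpen J) (hJc : IsConnected J)
    (hu : ContDiffOn ℝ 3 u J) (h0 : ∀ x ∈ J, u x ≠ 0) (h1 : ∀ x ∈ J, deriv u x ≠ 0) (κ m : ℝ)
    (h : ∀ x ∈ J, u x ^ 2 * deriv (deriv (deriv u)) x
        + (m - 2) * u x * deriv u x * deriv (deriv u) x - (m - 1) * deriv u x ^ 3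
        + κ * deriv u x = 0) :
    ∃ c : ℝ, ∀ x ∈ J,
      c = -(deriv (deriv (deriv u)) x / deriv u x + m * (deriv (deriv u) x / u x)) ∧
      c * u x ^ 2 = κ - (m - 1) * deriv u x ^ 2 - 2 * (u x * deriv (deriv u) x) := by
  have hu' : ContDiffOn ℝ 2 (deriv u) J := hu.deriv_of_isOpen hJ (by norm_num)
  let L : ℝ → ℝ := fun x => (κ - (m - 1) * deriv u x ^ 2 - 2 * (u x * deriv (deriv u) x)) / u x ^ 2
  have hL : ∀ x ∈ J, HasDerivAt L 0 x := by
    intro x hx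
    have d0 := ((hu.of_le (by norm_num)).hasDerivAt_deriv₂ hJ hx).1
    obtain ⟨d1, d2⟩ := hu'.hasDerivAt_deriv₂ hJ hx
    have hx0 := h0 x hx
    refine ((((d1.pow 2).const_mul (m - 1)).const_sub κ |>.sub ((d0.mul d2).const_mul 2)).div
      (d0.pow 2) (pow_ne_zero 2 hx0)).congr_deriv ?_
    simp
    left
    linear_combination (-2 * u x) * h x hx
  obtain ⟨x₀, hx₀⟩ := hJc.nonempty
  refine ⟨L x₀, fun x hx => ?_⟩
  have hconst : L x₀ = L x := hJ.is_const_of_deriv_eq_zero hJc.isPreconnected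
    (fun t ht => (hL t ht).differentiableAt.differentiableWithinAt)
    (fun t ht => (hL t ht).deriv) hx₀ hx
  have hx0 := h0 x hx
  have hx1 := h1 x hx
  rw [hconst]
  simp only [L]
  constructor
  · field_simp
    linear_combination h x hx
  · field_simp

end ScalarEquations

theorem iteratedDeriv_three (u : ℝ → ℝ) : iteratedDeriv 3 u = deriv (deriv (deriv u)) := by
  rw [iteratedDeriv_succ, iteratedDeriv_succ, iteratedDeriv_one]

theorem iteratedDeriv_two' (u : ℝ → ℝ) : iteratedDeriv 2 u = deriv (deriv u) := by
  rw [iteratedDeriv_succ, iteratedDeriv_one]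

theorem mainTheorem7
    {E : Type*} [NormedAddCommGroup E] [NormedSpace ℝ E] [FiniteDimensional ℝ E]
    {M : Type*} [TopologicalSpace M] [ChartedSpace E M] [Nonempty M]
    (r : WithTop ℕ∞) (hr : 2 ≤ r) [IsManifold 𝓘(ℝ, E) (r + 1) M]
    (n : ℕ) (hn : 2 ≤ n) (hdim : Module.finrank ℝ E + 1 = n)
    (k : ℝ) (g : PseudoRiem.BilinField 𝓘(ℝ, E) M)
    (hg : PseudoRiem.IsEinsteinOn r g Set.univ (k * ((n : ℝ) - 2)))
    (J : Set ℝ) (hJo : IsOpen J) (hJc : IsConnected J)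
    (u : ℝ → ℝ) (hu : ContDiffOn ℝ (r + 1) u J) (hpos : ∀ x ∈ J, 0 < u x) :
    -- the static equation on `J × M`
    (∀ f : ℝ → ℝ, ContDiffOn ℝ 2 f J → (∃ x ∈ J, f x ≠ 0) → (∃ x ∈ J, deriv u x ≠ 0) →
      (PseudoRiem.StaticEquationOn (PseudoRiem.warpedOverLine u g) (fun z : ℝ × M => f z.1)
          (J ×ˢ Set.univ) ↔
        (∃ a : ℝ, a ≠ 0 ∧ ∀ x ∈ J, f x = a * deriv u x) ∧
        ∀ x ∈ J, u x ^ 2 * iteratedDeriv 3 u x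
            + ((n : ℝ) - 3) * u x * deriv u x * iteratedDeriv 2 u x
            - ((n : ℝ) - 2) * deriv u x ^ 3 + k * ((n : ℝ) - 2) * deriv u x = 0)) ∧
    -- the Einstein metrics `± u'² dt² + dx² + u² g` on `ℝ × J × M`
    ((∀ x ∈ J, u x ^ 2 * iteratedDeriv 3 u x
            + ((n : ℝ) - 3) * u x * deriv u x * iteratedDeriv 2 u x
            - ((n : ℝ) - 2) * deriv u x ^ 3 + k * ((n : ℝ) - 2) * deriv u x = 0) →
      (∀ x ∈ J, deriv u x ≠ 0) →
      ∀ ε : ℝ, ε = 1 ∨ ε = -1 →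
        (∃ c : ℝ, PseudoRiem.IsEinsteinOn r (PseudoRiem.iteratedWarped ε u g)
          (Set.univ ×ˢ (J ×ˢ Set.univ)) c)) ∧
    -- the two ways to regard this metric as a warped product
    (∀ ε t x : ℝ, ∀ p : M, ∀ τ ξ τ' ξ' : ℝ, ∀ X X' : E,
        PseudoRiem.iteratedWarped ε u g (t, (x, p)) (τ, (ξ, X)) (τ', (ξ', X')) =
          PseudoRiem.warpedProduct (PseudoRiem.warpedOverLine u g) (fun z : ℝ × M => deriv u z.1)
            (PseudoRiem.lineMetric ε) ((x, p), t) ((ξ, X), τ) ((ξ', X'), τ') ∧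
        PseudoRiem.iteratedWarped ε u g (t, (x, p)) (τ, (ξ, X)) (τ', (ξ', X')) =
          PseudoRiem.warpedProduct (PseudoRiem.planeMetric ε (deriv u)) (fun z : ℝ × ℝ => u z.2)
            g ((t, x), p) ((τ, ξ), X) ((τ', ξ'), X')) := by
  have hM : IsManifold 𝓘(ℝ, E) 1 M := IsManifold.of_le (n := r + 1) le_add_self
  have hnt : Nontrivial E := Module.nontrivial_of_finrank_pos (R := ℝ) (by omega)
  have hm : (n : ℝ) = Module.finrank ℝ E + 1 := by rw [← hdim]; push_cast; ring
  have h3r : (3 : WithTop ℕ∞) ≤ r + 1 := by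
    have : (2 : WithTop ℕ∞) + 1 ≤ r + 1 := by gcongr
    exact le_trans (by norm_num) this
  have hu3 : ContDiffOn ℝ 3 u J := hu.of_le h3r
  have h0 : ∀ x ∈ J, u x ≠ 0 := fun x hx => (hpos x hx).ne'
  rw [iteratedDeriv_three, iteratedDeriv_two', hm, show (Module.finrank ℝ E : ℝ) + 1 - 3 =
    Module.finrank ℝ E - 2 by ring, show (Module.finrank ℝ E : ℝ) + 1 - 2 =
    Module.finrank ℝ E - 1 by ring]
  rw [hm, show (Module.finrank ℝ E : ℝ) + 1 - 2 = Module.finrank ℝ E - 1 by ring] at hg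
  refine ⟨fun f hf hf0 hu0 => ?_, fun hode h1 ε hε => ?_, fun ε t x p τ ξ τ' ξ' X X' => ?_⟩
  · rw [staticEquationOn_warpedOverLine_iff hr hg hJo (hu3.of_le (by norm_num)) h0 hf]
    exact static_scalar_equations_iff hJo hJc.isPreconnected hu3 h0 hf hf0 hu0 _ _
  · obtain ⟨c, hc⟩ := exists_einstein_constant hJo hJc hu3 h0 h1 _ _ hode
    have hε0 : ε ≠ 0 := by rcases hε with rfl | rfl <;> norm_num
    exact ⟨c, isEinsteinOn_iteratedWarped hr hg hJo hu h0 h1 hε0 (fun x hx => (hc x hx).1)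
      fun x hx => (hc x hx).2⟩
  · constructor
    · refine (iteratedWarped_apply ε u g _ _ _).trans
        (Eq.trans ?_ (PseudoRiem.orthSum_apply _ _ _ _).symm)
      change ε * deriv u x ^ 2 * (τ * τ') + _ = _ + deriv u x ^ 2 * (ε * (τ * τ'))
      rw [add_comm, mul_left_comm (deriv u x ^ 2), mul_assoc ε]
      rfl
    · refine (iteratedWarped_apply ε u g _ _ _).trans
        (Eq.trans ?_ (PseudoRiem.orthSum_apply _ _ _ _).symm)
      rw [warpedOverLine_apply]
      refine (add_assoc _ _ _).symm.trans ?_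
      congr 1
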